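/- **Setting.** Let $\Theta\subset\mathbb R^p$ and $\mathcal Y\subset\mathbb R^m$ be compact and convex, let $G:\Theta\times\mathcal Y\to\mathbb R^m$ be three times continuously differentiable, and let $\Pr(w\mid\theta,Y)>0$, for $(\theta,Y)\in\Theta\times\mathbb R^m$, be probability densities with respect to a fixed measure. Write $\gamma=(\theta,Y)$, $q(w,\gamma)=\ln\Pr(w\mid\gamma)$. Assume: * $w_1,w_2,\dots$ are i.i.d. with density $\Pr(\cdot\mid\gamma^*)$, where $\gamma^*=(\theta^*,Y^*)\in\operatorname{int}(\Theta\times\mathcal Y)$ and $G(\gamma^*)=0$. Put $Q_N(\gamma)=N^{-1}\sum_{i\le N}q(w_i,\gamma)$ and $Q^*(\gamma)=E[q(w_1,\gamma)]$. * $q(w,\cdot)$ is twice continuously differentiable on $\Theta\times\mathbb R^m$ for each $w$, and so is $Q^*$ on $\Theta\times\mathcal Y$; $\gamma^*$ is the unique maximizer of $Q^*$ on $\{\gamma\in\Theta\times\mathcal Y:G(\gamma)=0\}$; $\nabla_YG(\gamma^*)$ is nonsingular. * On $\Theta\times\mathcal Y$, $q$ and its first two derivatives in $\gamma$ are bounded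 in norm by integrable functions of $w$, and the score $\nabla_\gamma q(w,\gamma^*)$ is square-integrable (both automatic if there are finitely many possible observations). For $\gamma=(\breve\theta,Y)$ with $\nabla_YG(\gamma)$ nonsingular let $\Upsilon(\theta,\gamma)=Y-\nabla_YG(\breve\theta,Y)^{-1}G(\theta,Y)$. An EPL iteration in the sample of size $N$ maps $\gamma$ to $(\theta',\Upsilon(\theta',\gamma))$ with $\theta'\in\arg\max_{\theta\in\Theta}Q_N(\theta,\Upsilon(\theta,\gamma))$. Say that the iteration at $\gamma$ *has a unique solution* if this maximizer exists, is unique, and is the only point of $\Theta$ satisfying the first-order conditions of the maximization (the derivative at the point is $\le 0$ in every direction into $\Theta$; it vanishes at interior points). Assume finally that the information matrix $\Omega^*_{\theta\theta}=-\nabla_{\theta\theta'}\,Q^*(\theta,\Upsilon(\theta,\gamma^*))|_{\theta=\theta^*}$ is nonsingular. Let $\hat\gamma_{\rm MLE}=(\hat\theta_{\rm MLE},\hat Y_{\rm MLE})$ be a maximizer of $Q_N$ over $\{\gamma\in\Theta\times\mathcal Y:G(\gamma)=0\}$. **Theorem.** 1. In every sample in which $\hat Y_{\rm MLE}\in\operatorname{int}\mathcal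 Y$, $\nabla_YG(\hat\gamma_{\rm MLE})$ is nonsingular and the iteration at $\hat\gamma_{\rm MLE}$ has a unique solution, $\hat\gamma_{\rm MLE}$ is a fixed point: the EPL iteration maps $\hat\gamma_{\rm MLE}$ to $\hat\gamma_{\rm MLE}$ (and to nothing else). 2. Let $\hat\gamma_0$ be consistent for $\gamma^*$ (in particular, $\sqrt N$-consistent) and let $\hat\gamma_k$ be obtained from $\hat\gamma_{k-1}$ by an EPL iteration which, for each $k\ge1$, has a unique solution with probability approaching one. Then for all $k\ge1$ $$\|\hat\gamma_k-\hat\gamma_{\rm MLE}\|=O_p\big(N^{-1/2}\|\hat\gamma_{k-1}-\hat\gamma_{\rm MLE}\|+\|\hat\gamma_{k-1}-\hat\gamma_{\rm MLE}\|^2\big).$$ 3. Suppose that the iteration at $\hat\gamma_{\rm MLE}$ has a unique solution with probability approaching one. Then for every $\varepsilon>0$, with probability approaching one as $N\to\infty$, there is a neighborhood $\mathcal B\subseteq\Theta\times\mathcal Y$ of $\hat\gamma_{\rm MLE}$ on which the EPL iteration is a well-defined single-valued map of $\mathcal B$ into itself and a contraction with Lipschitz constant $L<\min(\varepsilon,1)$.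 -/

import Mathlib

open MeasureTheory ProbabilityTheory Filter Topology Set
open scoped NNReal ENNReal

namespace EPL

/-- The Euclidean space `ℝ^d`. -/
abbrev Vec (d : ℕ) : Type := EuclideanSpace ℝ (Fin d)

/-- Compound parameters `γ = (θ, Y)`. -/
abbrev Par (p m : ℕ) : Type := Vec p × Vec m

/-- The data of a likelihood model with structural parameter `θ ∈ Θ ⊆ ℝ^p`, nuisance parameter
`Y ∈ 𝒴 ⊆ ℝ^m` and equality constraint `G (θ, Y) = 0`.  `lik x (θ, Y)` is the likelihood of the
observation `x`: a density with respect to `ν` (counting measure for discrete observations).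
`γ₀ = (θ*, Y*)` is the true parameter. -/
structure Model (p m : ℕ) (𝒲 : Type*) [MeasurableSpace 𝒲] where
  Θ : Set (Vec p)
  𝒴 : Set (Vec m)
  G : Par p m → Vec m
  ν : Measure 𝒲
  lik : 𝒲 → Par p m → ℝ
  γ₀ : Par p m

section Model

variable {p m : ℕ} {𝒲 : Type*} [MeasurableSpace 𝒲] (M : Model p m 𝒲)

/-- The log-likelihood `q` of one observation. -/
noncomputable def Model.logLik (x : 𝒲) (γ : Par p m) : ℝ := Real.log (M.lik x γ)

/-- The distribution of one observation under the true parameter. -/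
noncomputable def Model.trueLaw : Measure 𝒲 :=
  M.ν.withDensity fun x => ENNReal.ofReal (M.lik x M.γ₀)

/-- The population objective `Q*(θ, Y) = E[q(θ, Y)]`. -/
noncomputable def Model.popQ (γ : Par p m) : ℝ := ∫ x, M.logLik x γ ∂M.trueLaw

/-- The sample objective `Q_N(θ, Y)` for the realized observations `x 0, …, x (N - 1)`. -/
noncomputable def Model.sampleQ (x : ℕ → 𝒲) (N : ℕ) (γ : Par p m) : ℝ :=
  (N : ℝ)⁻¹ * ∑ i ∈ Finset.range N, M.logLik (x i) γ

/-- The partial Jacobian `∇_Y G` at `γ = (θ, Y)` (one-sided on the boundary of `𝒴`). -/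
noncomputable def Model.jacY (γ : Par p m) : Vec m →L[ℝ] Vec m :=
  fderivWithin ℝ (fun y => M.G (γ.1, y)) M.𝒴 γ.2

/-- The Newton-like map `Υ(θ, γ) = Y - ∇_Y G(γ)⁻¹ G(θ, Y)`, where `Y` is the second component
of `γ`. -/
noncomputable def Model.upsilon (θ : Vec p) (γ : Par p m) : Vec m :=
  γ.2 - (M.jacY γ).inverse (M.G (θ, γ.2))

/-- The objective `θ ↦ Q_N(θ, Υ(θ, γ))` of the maximization in one iteration started at `γ`. -/
noncomputable def Model.stepObj (x : ℕ → 𝒲) (N : ℕ) (γ : Par p m) (θ : Vec p) : ℝ :=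
  M.sampleQ x N (θ, M.upsilon θ γ)

/-- The population analogue `θ ↦ Q*(θ, Υ(θ, γ*))` at the true parameter. -/
noncomputable def Model.popStepObj (θ : Vec p) : ℝ := M.popQ (θ, M.upsilon θ M.γ₀)

/-- The information matrix for `θ` at the true parameter, as a bilinear form:
`Ω*_θθ = - ∇_θθ' Q*(θ, Υ(θ, γ*))` at `θ = θ*`. -/
noncomputable def Model.information : Vec p →L[ℝ] Vec p →L[ℝ] ℝ :=
  -fderiv ℝ (fderiv ℝ M.popStepObj) M.γ₀.1

/-- `γ` is a constrained maximum likelihood estimate. -/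
def Model.IsMLE (x : ℕ → 𝒲) (N : ℕ) (γ : Par p m) : Prop :=
  γ ∈ M.Θ ×ˢ M.𝒴 ∧ M.G γ = 0 ∧
    ∀ γ' ∈ M.Θ ×ˢ M.𝒴, M.G γ' = 0 → M.sampleQ x N γ' ≤ M.sampleQ x N γ

/-- `γ'` is obtained from `γ` by one iteration: its first component maximizes the objective over
`Θ`, and its second component is the corresponding update of `Y`. -/
def Model.IsEPLStep (x : ℕ → 𝒲) (N : ℕ) (γ γ' : Par p m) : Prop :=
  (M.jacY γ).IsInvertible ∧ γ'.1 ∈ M.Θ ∧ IsMaxOn (M.stepObj x N γ) M.Θ γ'.1 ∧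
    γ'.2 = M.upsilon γ'.1 γ

/-- First-order conditions for maximizing `f` over a convex set `s`
(`∇f(θ) = 0` when `θ` is interior). -/
def IsFirstOrderPoint {d : ℕ} (f : Vec d → ℝ) (s : Set (Vec d)) (θ : Vec d) : Prop :=
  θ ∈ s ∧ ∀ θ' ∈ s, fderivWithin ℝ f s θ (θ' - θ) ≤ 0

/-- The maximization in the iteration started at `γ` has a unique solution, and this solution is
the only point that satisfies the first-order conditions. -/
def Model.HasUniqueSolution (x : ℕ → 𝒲) (N : ℕ) (γ : Par p m) : Prop :=
  (∃! θ, θ ∈ M.Θ ∧ IsMaxOn (M.stepObj x N γ) M.Θ θ) ∧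
    ∀ θ, IsFirstOrderPoint (M.stepObj x N γ) M.Θ θ → IsMaxOn (M.stepObj x N γ) M.Θ θ

/-- The basic assumptions on the model and on the sequence `w` of observations. -/
structure BasicAssumptions {Ω : Type*} [MeasurableSpace Ω] (μ : Measure Ω) (w : ℕ → Ω → 𝒲) :
    Prop where
  /-- `lik` is a positive probability density at every parameter value. -/
  lik_pos : ∀ x, ∀ γ ∈ M.Θ ×ˢ (univ : Set (Vec m)), 0 < M.lik x γ
  lik_measurable : ∀ γ ∈ M.Θ ×ˢ (univ : Set (Vec m)), Measurable fun x => M.lik x γ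
  lik_lintegral : ∀ γ ∈ M.Θ ×ˢ (univ : Set (Vec m)), ∫⁻ x, ENNReal.ofReal (M.lik x γ) ∂M.ν = 1
  /-- The observations are i.i.d. and generated by `γ₀`, which satisfies the constraint. -/
  obs_measurable : ∀ i, Measurable (w i)
  obs_indep : iIndepFun w μ
  obs_law : ∀ i, μ.map (w i) = M.trueLaw
  constraint : M.G M.γ₀ = 0
  /-- The parameter spaces are compact and convex, and the true parameter is interior. -/
  compact_Θ : IsCompact M.Θ
  compact_𝒴 : IsCompact M.𝒴
  convex_Θ : Convex ℝ M.Θ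
  convex_𝒴 : Convex ℝ M.𝒴
  interior : M.γ₀ ∈ interior (M.Θ ×ˢ M.𝒴)
  /-- The objectives are twice continuously differentiable. -/
  logLik_contDiff : ∀ x, ContDiffOn ℝ 2 (M.logLik x) (M.Θ ×ˢ (univ : Set (Vec m)))
  popQ_contDiff : ContDiffOn ℝ 2 M.popQ (M.Θ ×ˢ M.𝒴)
  /-- `γ₀` is the unique maximizer of the population objective under the constraint. -/
  identification : ∀ γ ∈ M.Θ ×ˢ M.𝒴, M.G γ = 0 → γ ≠ M.γ₀ → M.popQ γ < M.popQ M.γ₀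
  /-- The constraint is thrice continuously differentiable and regular at `γ₀`. -/
  G_contDiff : ContDiffOn ℝ 3 M.G (M.Θ ×ˢ M.𝒴)
  jacY_invertible : (M.jacY M.γ₀).IsInvertible

/-- Standard regularity of the likelihood.  The first two conditions hold automatically when there
are finitely many possible observations. -/
structure LikelihoodRegularity : Prop where
  dominated : ∀ i ≤ 2, ∃ B : 𝒲 → ℝ, Integrable B M.trueLaw ∧ ∀ x, ∀ γ ∈ M.Θ ×ˢ M.𝒴,
    ‖iteratedFDerivWithin ℝ i (M.logLik x) (M.Θ ×ˢ (univ : Set (Vec m))) γ‖ ≤ B x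
  score_sq : Integrable (fun x => ‖fderiv ℝ (M.logLik x) M.γ₀‖ ^ 2) M.trueLaw
  information_nonsingular : ∀ u, M.information u = 0 → u = 0

end Model

/-- `A N` holds with probability approaching one as `N → ∞`. -/
def WPA1 {Ω : Type*} [MeasurableSpace Ω] (μ : Measure Ω) (A : ℕ → Ω → Prop) : Prop :=
  Tendsto (fun N => μ {ω | ¬ A N ω}) atTop (𝓝 0)

/-- `X N = O_p(a N)` for random vectors `X N` and nonnegative random variables `a N`. -/
def IsBigOp {Ω E : Type*} [MeasurableSpace Ω] [Norm E] (μ : Measure Ω) (X : ℕ → Ω → E)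
    (a : ℕ → Ω → ℝ) : Prop :=
  ∀ ε : ℝ, 0 < ε → ∃ C : ℝ, ∀ᶠ N in atTop, μ {ω | C * a N ω < ‖X N ω‖} ≤ ENNReal.ofReal ε

end EPL

/-!
The first-order conditions of an iteration started at `γ` are governed by its score
`F (θ, γ) = ∇_θ [Q_N (θ, Υ(θ, γ))]`, and a single fact about `F` yields all three conclusions.
Write `Ψ (θ, γ) = (θ, Υ(θ, γ))`, so that `F z = ∇Q_N (Ψ z) ∘ A z` with `A` the `θ`-derivative of
`Ψ`. A Newton step from a feasible point does not depend on its starting point to first order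
(`hasFDerivAt_updatePt_snd`), and the expected score `∇Q*(γ*)` vanishes by the information
inequality (`popQ_le`). Therefore, near `(θ*, γ*)` and with probability approaching one, `F` varies
like `-Ω* θ` up to an arbitrarily small multiple of the increment of `(θ, γ)`. As `Ω*` is
nonsingular, roots of `F (·, γ)` exist and are unique near `θ*`, and they move with `γ` at an
arbitrarily small Lipschitz rate; so does the update `Ψ` (`exists_isGoodObjective`).

* The estimate is a fixed point because the tangent of `θ ↦ Ψ (θ, γ)` at a feasible `γ` is tangent
  to the constraint set. Since the estimate of `θ` may lie on the boundary of `Θ`, this is proved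
  with one-sided feasible curves (`exists_curve_of_zeros`).
* The root near `θ*` satisfies the first-order conditions, hence is the maximizer whenever the
  iteration has a unique solution: iterates stay local although the objective is maximized over
  all of `Θ`. At the estimate, `F (θ̂, γ) - F (θ̂, γ̂)` is bounded by `‖∇Q_N(γ̂)‖ ‖γ - γ̂‖` plus a
  quadratic term, and `∇Q_N(γ̂)` is of the order of `∇Q_N(γ*)`, which is `O_p(N^{-1/2})` by
  Chebyshev's inequality (`isBigOp_score`).
* For starting points near the estimate, compactness of `Θ` keeps the maximizers near `θ*`, where
  the Lipschitz dependence of the roots gives the contraction (`exists_contraction`).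

The probabilistic input is the law of large numbers together with stochastic equicontinuity of
dominated continuous families (`exists_wpa1_average_oscillation`). It gives the consistency of the
estimate when applied to the log-likelihood, and the near linearity of `∇Q_N` when applied to its
Hessian. The iterates and estimates are not assumed measurable, so every estimate of a probability
is an inclusion into an event that depends on the observations through averages.
-/

namespace EPL


/-! ### Estimates for nearly linear maps -/

section Estimates

variable {E P K : Type*} [NormedAddCommGroup E] [NormedSpace ℝ E] [NormedAddCommGroup P]
  [NormedSpace ℝ P] [NormedAddCommGroup K] [NormedSpace ℝ K]

/-- If the score `F (θ, γ)` varies like `S θ` with `S` invertible, and the update `Ψ (θ, γ)` varies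
like `A θ`, both up to a small multiple of the increment of `(θ, γ)`, then `θ` and the update are
controlled by the score, up to an arbitrarily small multiple of the increment of `γ`. -/
theorem exists_score_solve_bound (S : E ≃L[ℝ] K) (A : E →L[ℝ] P) {κ : ℝ} (hκ : 0 < κ) :
    ∃ C > 0, ∃ η > 0, ∀ (s : Set (E × P)) (F : E × P → K) (Ψ : E × P → P),
      (∀ z₁ ∈ s, ∀ z₂ ∈ s, ‖F z₁ - F z₂ - S (z₁.1 - z₂.1)‖ ≤ η * ‖z₁ - z₂‖) →
      (∀ z₁ ∈ s, ∀ z₂ ∈ s, ‖Ψ z₁ - Ψ z₂ - A (z₁.1 - z₂.1)‖ ≤ η * ‖z₁ - z₂‖) →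
      ∀ z₁ ∈ s, ∀ z₂ ∈ s,
        ‖z₁.1 - z₂.1‖ ≤ C * ‖F z₁ - F z₂‖ + κ * ‖z₁.2 - z₂.2‖ ∧
        ‖Ψ z₁ - Ψ z₂‖ ≤ C * ‖F z₁ - F z₂‖ + κ * ‖z₁.2 - z₂.2‖ := by
  set b : ℝ := ‖(S.symm : K →L[ℝ] E)‖ + 1 with hb
  set a : ℝ := ‖A‖ + 1 with ha
  have hb0 : 1 ≤ b := by have := norm_nonneg (S.symm : K →L[ℝ] E); linarith
  have ha0 : 1 ≤ a := by have := norm_nonneg A; linarith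
  have hab : 0 < 2 * b * a + 1 := by positivity
  refine ⟨a * (2 * b), by positivity, min (1 / (2 * b)) (min 1 (κ / (2 * b * a + 1))),
    by positivity, ?_⟩
  set η := min (1 / (2 * b)) (min 1 (κ / (2 * b * a + 1))) with hη
  have hη0 : 0 < η := by positivity
  have h1 : b * η ≤ 1 / 2 := by
    have : η ≤ 1 / (2 * b) := min_le_left _ _
    calc b * η ≤ b * (1 / (2 * b)) := by gcongr
      _ = 1 / 2 := by field_simp
  have h2 : η ≤ 1 := (min_le_right _ _).trans (min_le_left _ _)
  have h3 : (2 * b * a + 1) * η ≤ κ := by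
    have : η ≤ κ / (2 * b * a + 1) := (min_le_right _ _).trans (min_le_right _ _)
    rwa [le_div_iff₀' hab] at this
  intro s F Ψ hF hΨ z₁ hz₁ z₂ hz₂
  set x := ‖z₁.1 - z₂.1‖ with hx
  set y := ‖z₁.2 - z₂.2‖ with hy
  set f := ‖F z₁ - F z₂‖ with hf
  have hx0 : 0 ≤ x := norm_nonneg _
  have hy0 : 0 ≤ y := norm_nonneg _
  have hf0 : 0 ≤ f := norm_nonneg _
  have hz : ‖z₁ - z₂‖ ≤ x + y := by
    rw [Prod.norm_def]
    exact max_le (by simp [hx, hy]) (by simp [hx, hy])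
  have hS : x ≤ b * (f + η * (x + y)) := by
    have e1 : ‖S (z₁.1 - z₂.1)‖ ≤ f + η * (x + y) := by
      have := hF z₁ hz₁ z₂ hz₂
      have t := norm_sub_le (F z₁ - F z₂) (F z₁ - F z₂ - S (z₁.1 - z₂.1))
      rw [sub_sub_cancel] at t
      have : η * ‖z₁ - z₂‖ ≤ η * (x + y) := by gcongr
      linarith
    have e2 : x = ‖(S.symm : K →L[ℝ] E) (S (z₁.1 - z₂.1))‖ := by simp [hx]
    have e3 := (S.symm : K →L[ℝ] E).le_opNorm (S (z₁.1 - z₂.1))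
    rw [← e2] at e3
    refine e3.trans ?_
    have : ‖(S.symm : K →L[ℝ] E)‖ ≤ b := by linarith
    gcongr
  have hx1 : x ≤ 2 * b * f + 2 * b * η * y := by nlinarith
  have hΨ1 : ‖Ψ z₁ - Ψ z₂‖ ≤ a * x + η * y := by
    have t := norm_add_le (Ψ z₁ - Ψ z₂ - A (z₁.1 - z₂.1)) (A (z₁.1 - z₂.1))
    rw [sub_add_cancel] at t
    have u := hΨ z₁ hz₁ z₂ hz₂
    have v := A.le_opNorm (z₁.1 - z₂.1)
    have : η * ‖z₁ - z₂‖ ≤ η * (x + y) := by gcongr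
    have : η * x ≤ x := by nlinarith
    have : a * x = ‖A‖ * x + x := by rw [ha]; ring
    nlinarith
  have hfin : a * x + η * y ≤ a * (2 * b) * f + κ * y := by
    calc a * x + η * y ≤ a * (2 * b * f + 2 * b * η * y) + η * y := by gcongr
      _ = a * (2 * b) * f + ((2 * b * a + 1) * η) * y := by ring
      _ ≤ _ := by gcongr
  refine ⟨?_, hΨ1.trans hfin⟩
  have : x ≤ a * x := by nlinarith
  have : 0 ≤ η * y := by positivity
  linarith

/-- The score of an objective with gradient `D`, composed with the update map `Ψ` whose
`θ`-derivative is `A z`, is nearly linear in `θ` and nearly independent of `γ`. -/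
theorem norm_score_sub_sub_le {H : P →L[ℝ] P →L[ℝ] ℝ} {A₀ : E →L[ℝ] P}
    {D : P → P →L[ℝ] ℝ} {Ψ : E × P → P} {A : E × P → E →L[ℝ] P} {η C : ℝ}
    (hη1 : η ≤ 1) {z₁ z₂ : E × P}
    (hD : ‖D (Ψ z₁) - D (Ψ z₂) - H (Ψ z₁ - Ψ z₂)‖ ≤ η * ‖Ψ z₁ - Ψ z₂‖)
    (hD2 : ‖D (Ψ z₂)‖ ≤ η)
    (hΨ : ‖Ψ z₁ - Ψ z₂ - A₀ (z₁.1 - z₂.1)‖ ≤ η * ‖z₁ - z₂‖)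
    (hAL : ‖A z₁ - A z₂‖ ≤ C * ‖z₁ - z₂‖) (hA : ‖A z₁ - A₀‖ ≤ η) :
    ‖(D (Ψ z₁)).comp (A z₁) - (D (Ψ z₂)).comp (A z₂) - (H (A₀ (z₁.1 - z₂.1))).comp A₀‖
      ≤ ((‖A₀‖ + 1) ^ 2 + ‖H‖ * (‖A₀‖ + 1) + ‖H‖ * ‖A₀‖ + C) * η * ‖z₁ - z₂‖ := by
  set d := ‖z₁ - z₂‖ with hd
  have hd0 : 0 ≤ d := norm_nonneg _
  have hη : 0 ≤ η := (norm_nonneg _).trans hA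
  set u := z₁.1 - z₂.1 with hu
  have hud : ‖u‖ ≤ d := norm_fst_le (z₁ - z₂)
  set α := ‖A₀‖ with hα
  have hα0 : 0 ≤ α := norm_nonneg _
  have hA1 : ‖A z₁‖ ≤ α + 1 := by
    have := norm_add_le (A z₁ - A₀) A₀
    rw [sub_add_cancel] at this
    linarith
  have hΔ : ‖Ψ z₁ - Ψ z₂‖ ≤ (α + 1) * d := by
    have t := norm_add_le (Ψ z₁ - Ψ z₂ - A₀ u) (A₀ u)
    rw [sub_add_cancel] at t
    have v : ‖A₀ u‖ ≤ α * d := (A₀.le_opNorm u).trans (by gcongr)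
    nlinarith
  have key : (D (Ψ z₁)).comp (A z₁) - (D (Ψ z₂)).comp (A z₂) - (H (A₀ u)).comp A₀
      = (D (Ψ z₁) - D (Ψ z₂) - H (Ψ z₁ - Ψ z₂)).comp (A z₁)
        + (H (Ψ z₁ - Ψ z₂ - A₀ u)).comp (A z₁) + (H (A₀ u)).comp (A z₁ - A₀)
        + (D (Ψ z₂)).comp (A z₁ - A z₂) := by
    ext v
    simp only [sub_apply, add_apply,
      ContinuousLinearMap.comp_apply, map_sub]
    ring
  rw [key]
  have t1 : ‖(D (Ψ z₁) - D (Ψ z₂) - H (Ψ z₁ - Ψ z₂)).comp (A z₁)‖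
      ≤ η * ((α + 1) * d) * (α + 1) :=
    (ContinuousLinearMap.opNorm_comp_le _ _).trans
      (mul_le_mul (hD.trans (by gcongr)) hA1 (norm_nonneg _) (by positivity))
  have t2 : ‖(H (Ψ z₁ - Ψ z₂ - A₀ u)).comp (A z₁)‖ ≤ ‖H‖ * (η * d) * (α + 1) :=
    (ContinuousLinearMap.opNorm_comp_le _ _).trans
      (mul_le_mul ((H.le_opNorm _).trans (by gcongr)) hA1 (norm_nonneg _) (by positivity))
  have t3 : ‖(H (A₀ u)).comp (A z₁ - A₀)‖ ≤ ‖H‖ * (α * d) * η :=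
    (ContinuousLinearMap.opNorm_comp_le _ _).trans
      (mul_le_mul ((H.le_opNorm _).trans
        (by gcongr; exact (A₀.le_opNorm u).trans (by gcongr))) hA (norm_nonneg _) (by positivity))
  have t4 : ‖(D (Ψ z₂)).comp (A z₁ - A z₂)‖ ≤ η * (C * d) :=
    (ContinuousLinearMap.opNorm_comp_le _ _).trans
      (mul_le_mul hD2 hAL (norm_nonneg _) hη)
  calc _ ≤ _ := norm_add₄_le
    _ ≤ η * ((α + 1) * d) * (α + 1) + ‖H‖ * (η * d) * (α + 1) + ‖H‖ * (α * d) * η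
        + η * (C * d) := by gcongr
    _ = _ := by ring

end Estimates


/-! ### Feasible curves and first-order conditions -/

section Curves

variable {X Y Z : Type*} [NormedAddCommGroup X] [NormedSpace ℝ X] [NormedAddCommGroup Y]
  [NormedSpace ℝ Y] [NormedAddCommGroup Z] [NormedSpace ℝ Z]

/-- A right inverse of a continuous linear equivalence with a positive norm bound (also between
trivial spaces). -/
noncomputable def posRightInverse (e : Y ≃L[ℝ] Z) :
    (e : Y →L[ℝ] Z).NonlinearRightInverse where
  toFun := e.symm
  nnnorm := ‖(e.symm : Z →L[ℝ] Y)‖₊ + 1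
  bound' y := by
    have := (e.symm : Z →L[ℝ] Y).le_opNorm y
    rw [ContinuousLinearEquiv.coe_coe] at this
    push_cast
    nlinarith [norm_nonneg y]
  right_inv' y := by simp

theorem posRightInverse_nnnorm_pos (e : Y ≃L[ℝ] Z) : 0 < ((posRightInverse e).nnnorm : ℝ) := by
  simp only [posRightInverse]
  positivity

/-- A one-sided implicit function theorem.  At a zero `(x, y)` of `G` with `y` interior to `T` and
invertible partial derivative in `Y`, every direction `h` into the convex set `S` is the
`X`-component of the tangent of a curve of zeros of `G`; `x` may lie on the boundary of `S`. -/
theorem exists_curve_of_zeros [CompleteSpace Y] {S : Set X} {T : Set Y} {G : X × Y → Z}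
    (hS : Convex ℝ S) (hT : Convex ℝ T) (hSn : (interior S).Nonempty) {x : X} {y : Y} (hx : x ∈ S)
    (hy : y ∈ interior T) (hG : ContDiffOn ℝ 1 G (S ×ˢ T)) (h0 : G (x, y) = 0) (e : Y ≃L[ℝ] Z)
    (he : (e : Y →L[ℝ] Z)
      = (fderivWithin ℝ G (S ×ˢ T) (x, y)).comp (ContinuousLinearMap.inr ℝ X Y))
    {h : X} (hh : x + h ∈ S) :
    ∃ c : ℝ → Y, c 0 = y ∧
      HasDerivWithinAt c (-e.symm (fderivWithin ℝ G (S ×ˢ T) (x, y) (h, 0))) (Icc 0 1) 0 ∧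
      ∀ᶠ t in 𝓝[Icc 0 1] (0 : ℝ), c t ∈ T ∧ G (x + t • h, c t) = 0 := by
  set D := fderivWithin ℝ G (S ×ˢ T) with hD
  have hyT : y ∈ T := interior_subset hy
  have hxy : (x, y) ∈ S ×ˢ T := ⟨hx, hyT⟩
  have hU : UniqueDiffOn ℝ (S ×ˢ T) :=
    (uniqueDiffOn_convex hS hSn).prod (uniqueDiffOn_convex hT ⟨y, hy⟩)
  have hDc : ContinuousOn D (S ×ˢ T) := hG.continuousOn_fderivWithin hU le_rfl
  have hGd : ∀ z ∈ S ×ˢ T, HasFDerivWithinAt G (D z) (S ×ˢ T) z := fun z hz =>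
    (hG.differentiableOn one_ne_zero z hz).hasFDerivWithinAt
  have hseg : ∀ t ∈ Icc (0 : ℝ) 1, x + t • h ∈ S := fun t ht => hS.add_smul_mem hx hh ht
  set R := posRightInverse e
  have hR : 0 < (R.nnnorm : ℝ) := posRightInverse_nnnorm_pos e
  -- half of the invertibility margin of `e`
  set k : ℝ≥0 := R.nnnorm⁻¹ / 2 with hk
  have hk' : (k : ℝ) = (R.nnnorm : ℝ)⁻¹ / 2 := by simp [hk]
  have hk0 : 0 < (k : ℝ) := by rw [hk']; positivity
  obtain ⟨δ, hδ, hδD⟩ : ∃ δ > 0, ∀ z ∈ S ×ˢ T, dist z (x, y) < δ → dist (D z) (D (x, y)) < k :=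
    Metric.continuousWithinAt_iff.1 (hDc _ hxy) k hk0 |>.imp fun δ h => ⟨h.1, fun z hz => h.2 hz⟩
  obtain ⟨δ', hδ', hδT⟩ := Metric.isOpen_iff.1 isOpen_interior y hy
  set r := min δ δ' with hr
  have hr0 : 0 < r := lt_min hδ hδ'
  have hball : Metric.ball y r ⊆ T := fun y' hy' =>
    interior_subset (hδT (Metric.ball_subset_ball (min_le_right _ _) hy'))
  -- the predicted curve `y + t v` violates the constraint only by `o(t)`
  set v : Y := -e.symm (D (x, y) (h, 0)) with hv
  set b : ℝ → Y := fun t => y + t • v with hb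
  have hb' : HasDerivAt b v 0 := by
    simpa [hb] using ((hasDerivAt_id (0 : ℝ)).smul_const v).const_add y
  have hb0 : b 0 = y := by simp [hb]
  have hbc : Tendsto b (𝓝[Icc 0 1] 0) (𝓝 y) := by
    have := hb'.continuousAt.tendsto
    rw [hb0] at this
    exact this.mono_left nhdsWithin_le_nhds
  set g : ℝ → Z := fun t => G (x + t • h, b t) with hg
  have hsc : ∀ t : ℝ, t ∈ Icc (0 : ℝ) 1 → dist (x + t • h) x < δ →
      ∀ y' ∈ Metric.ball y r, dist (D (x + t • h, y')) (D (x, y)) < k := by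
    intro t ht htd y' hy'
    refine hδD _ ⟨hseg t ht, hball hy'⟩ ?_
    rw [Prod.dist_eq]
    exact max_lt htd ((Metric.mem_ball.1 hy').trans_le (min_le_left _ _))
  have hGv : D (x, y) (h, v) = 0 := by
    have e1 : D (x, y) (0, v) = e v := by
      have := congrArg (fun L : Y →L[ℝ] Z => L v) he
      simpa using this.symm
    have e2 : ((h, v) : X × Y) = (h, 0) + (0, v) := by simp
    rw [e2, map_add, e1, hv]
    simp
  have hxt : HasDerivAt (fun t : ℝ => x + t • h) h 0 := by
    simpa using ((hasDerivAt_id (0 : ℝ)).smul_const h).const_add x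
  have hxc : Tendsto (fun t : ℝ => x + t • h) (𝓝[Icc 0 1] 0) (𝓝 x) := by
    have := hxt.continuousAt.tendsto
    simp only [zero_smul, add_zero] at this
    exact this.mono_left nhdsWithin_le_nhds
  have hg0 : g 0 = 0 := by simp [hg, hb0, h0]
  have hgd : HasDerivWithinAt g 0 (Icc 0 1) 0 := by
    have h1 : HasDerivWithinAt (fun t : ℝ => (x + t • h, b t)) (h, v) (Icc 0 1 ∩ b ⁻¹' T) 0 :=
      (hxt.prodMk hb').hasDerivWithinAt
    have h2 : HasFDerivWithinAt G (D (x, y)) (S ×ˢ T) (x + (0 : ℝ) • h, b 0) := by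
      simpa [hb0] using hGd _ hxy
    have h3 := h2.comp_hasDerivWithinAt (t := S ×ˢ T) 0 h1 fun t ht => ⟨hseg t ht.1, ht.2⟩
    rw [hGv] at h3
    refine h3.mono_of_mem_nhdsWithin (inter_mem self_mem_nhdsWithin ?_)
    exact hbc (mem_of_superset (Metric.ball_mem_nhds y hr0) hball)
  have hgo : g =o[𝓝[Icc 0 1] 0] fun t => t := by
    simpa [hg0] using hgd.isLittleO
  -- a zero is found in the ball around `b t` whose radius is proportional to the violation
  set ε : ℝ → ℝ := fun t => 2 * R.nnnorm * ‖g t‖ with hε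
  have hεc : Tendsto ε (𝓝[Icc 0 1] 0) (𝓝 0) := by
    have := (hgd.continuousWithinAt.tendsto.norm).const_mul (2 * (R.nnnorm : ℝ))
    simpa [hg0] using this
  have hsolve : ∀ t ∈ Icc (0 : ℝ) 1, dist (x + t • h) x < δ →
      Metric.closedBall (b t) (ε t) ⊆ Metric.ball y r →
      ∃ y' ∈ Metric.closedBall (b t) (ε t), G (x + t • h, y') = 0 := by
    intro t ht htd hsub
    have happ : ApproximatesLinearOn (fun y' => G (x + t • h, y')) (e : Y →L[ℝ] Z)
        (Metric.ball y r) k := by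
      intro y₁ hy₁ y₂ hy₂
      have hd : ∀ y' ∈ Metric.ball y r, HasFDerivWithinAt (fun y' => G (x + t • h, y'))
          ((D (x + t • h, y')).comp (ContinuousLinearMap.inr ℝ X Y)) (Metric.ball y r) y' := by
        intro y' hy'
        refine (hGd (x + t • h, y') ⟨hseg t ht, hball hy'⟩).comp y'
          (hasFDerivAt_prodMk_right _ _).hasFDerivWithinAt fun z hz => ⟨hseg t ht, hball hz⟩
      refine Convex.norm_image_sub_le_of_norm_hasFDerivWithin_le' hd (fun y' hy' => ?_)
        (convex_ball y r) hy₂ hy₁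
      rw [he, ← ContinuousLinearMap.sub_comp]
      refine (ContinuousLinearMap.opNorm_comp_le _ _).trans ?_
      have h1 := hsc t ht htd y' hy'
      rw [dist_eq_norm] at h1
      calc _ ≤ (k : ℝ) * 1 := mul_le_mul h1.le (ContinuousLinearMap.norm_inr_le_one ℝ X Y)
            (norm_nonneg _) hk0.le
        _ = k := mul_one _
    have := happ.surjOn_closedBall_of_nonlinearRightInverse R (by positivity) hsub
    obtain ⟨y', hy', hy'0⟩ := this (a := 0) (by
      rw [mem_closedBall_iff_norm', sub_zero, hk', hε]
      apply le_of_eq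
      change ‖g t‖ = _
      field_simp
      ring)
    exact ⟨y', hy', hy'0⟩
  have hgood : ∀ᶠ t in 𝓝[Icc 0 1] (0 : ℝ), t ∈ Icc (0 : ℝ) 1 ∧ dist (x + t • h) x < δ ∧
      Metric.closedBall (b t) (ε t) ⊆ Metric.ball y r := by
    refine eventually_mem_nhdsWithin.and ((hxc.eventually (Metric.ball_mem_nhds x hδ)).and ?_)
    filter_upwards [hbc.eventually (Metric.ball_mem_nhds y (half_pos hr0)),
      hεc.eventually (gt_mem_nhds (half_pos hr0))] with t h1 h2
    exact Metric.closedBall_subset_ball' (by linarith [Metric.mem_ball.1 h1])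
  have hch : ∀ t : ℝ, ∃ y' : Y, (t ∈ Icc (0 : ℝ) 1 ∧ dist (x + t • h) x < δ ∧
      Metric.closedBall (b t) (ε t) ⊆ Metric.ball y r) →
      y' ∈ Metric.closedBall (b t) (ε t) ∧ G (x + t • h, y') = 0 := by
    intro t
    by_cases ht : t ∈ Icc (0 : ℝ) 1 ∧ dist (x + t • h) x < δ ∧
      Metric.closedBall (b t) (ε t) ⊆ Metric.ball y r
    · obtain ⟨y', h1, h2⟩ := hsolve t ht.1 ht.2.1 ht.2.2
      exact ⟨y', fun _ => ⟨h1, h2⟩⟩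
    · exact ⟨y, fun h => absurd h ht⟩
  choose c hc using hch
  have hc0 : c 0 = y := by
    have h1 := (hc 0 (hgood.self_of_nhdsWithin (by simp))).1
    rw [hε] at h1
    simpa [hg0, hb0] using h1
  refine ⟨c, hc0, ?_, ?_⟩
  · rw [hasDerivWithinAt_iff_isLittleO]
    have h1 : (fun t => c t - b t) =o[𝓝[Icc 0 1] 0] fun t : ℝ => t := by
      refine Asymptotics.IsBigO.trans_isLittleO ?_ hgo
      refine Asymptotics.IsBigO.of_bound (2 * R.nnnorm) ?_
      filter_upwards [hgood] with t ht
      have := (hc t ht).1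
      rwa [mem_closedBall_iff_norm] at this
    refine h1.congr' (Eventually.of_forall fun t => ?_) (Eventually.of_forall fun t => ?_)
    · simp only [hc0, hb, sub_zero]
      abel
    · simp
  · filter_upwards [hgood] with t ht
    obtain ⟨h1, h2⟩ := hc t ht
    exact ⟨hball (ht.2.2 h1), h2⟩

end Curves

section FirstOrder

variable {p m : ℕ} {𝒲 : Type*} [MeasurableSpace 𝒲] {M : Model p m 𝒲}

/-- The partial derivative `∇_Y G` as a component of the full derivative of `G`. -/
theorem jacY_eq_comp_inr (h𝒴 : Convex ℝ M.𝒴)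
    (hG : ContDiffOn ℝ 1 M.G (M.Θ ×ˢ M.𝒴)) {γ : Par p m} (h1 : γ.1 ∈ M.Θ)
    (h2 : γ.2 ∈ interior M.𝒴) :
    M.jacY γ = (fderivWithin ℝ M.G (M.Θ ×ˢ M.𝒴) γ).comp
      (ContinuousLinearMap.inr ℝ (Vec p) (Vec m)) := by
  have h2' := interior_subset h2
  have h := (hG.differentiableOn one_ne_zero (γ.1, γ.2) ⟨h1, h2'⟩).hasFDerivWithinAt.comp γ.2
    (hasFDerivAt_prodMk_right γ.1 γ.2).hasFDerivWithinAt
    (fun z (hz : z ∈ M.𝒴) => ⟨h1, hz⟩)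
  exact h.fderivWithin ((uniqueDiffOn_convex h𝒴 ⟨_, h2⟩) _ h2')

/-- A constrained maximizer with interior nuisance parameter satisfies the first-order conditions
of the iteration started at it: every direction into `Θ` lifts to a feasible curve, whose tangent
`(h, -J⁻¹ ∇_θ G h)` is also the tangent of `θ ↦ (θ, Υ(θ, γ))`. -/
theorem IsFirstOrderPoint.of_constrained_max (hΘ : Convex ℝ M.Θ) (h𝒴 : Convex ℝ M.𝒴)
    (hΘn : (interior M.Θ).Nonempty) (hG : ContDiffOn ℝ 1 M.G (M.Θ ×ˢ M.𝒴))
    {Q : Par p m → ℝ} (hQ : DifferentiableOn ℝ Q (M.Θ ×ˢ univ)) {γ : Par p m} (h1 : γ.1 ∈ M.Θ)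
    (h2 : γ.2 ∈ interior M.𝒴) (hγ : M.G γ = 0) (hJ : (M.jacY γ).IsInvertible)
    (hmax : ∀ γ' ∈ M.Θ ×ˢ M.𝒴, M.G γ' = 0 → Q γ' ≤ Q γ) :
    IsFirstOrderPoint (fun θ => Q (θ, M.upsilon θ γ)) M.Θ γ.1 := by
  obtain ⟨e, he⟩ := hJ
  refine ⟨h1, fun θ' hθ' => ?_⟩
  have h2' := interior_subset h2
  set D := fderivWithin ℝ M.G (M.Θ ×ˢ M.𝒴) γ with hD
  have hJ' := jacY_eq_comp_inr h𝒴 hG h1 h2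
  set h := θ' - γ.1 with hh
  have hin : γ.1 + h ∈ M.Θ := by simpa [hh] using hθ'
  obtain ⟨c, hc0, hcd, hcz⟩ := exists_curve_of_zeros (x := γ.1) (y := γ.2) hΘ h𝒴 hΘn h1 h2 hG hγ e
    (he.trans hJ') hin
  set DQ := fderivWithin ℝ Q (M.Θ ×ˢ univ) γ with hDQ
  have hQd : HasFDerivWithinAt Q DQ (M.Θ ×ˢ univ) γ := (hQ γ ⟨h1, trivial⟩).hasFDerivWithinAt
  -- the derivative of the iteration objective
  have hΥ : ∀ θ, M.upsilon θ γ = γ.2 - e.symm (M.G (θ, γ.2)) := by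
    intro θ
    simp [Model.upsilon, ← he]
  have hobj : HasFDerivWithinAt (fun θ => Q (θ, M.upsilon θ γ))
      (DQ.comp ((ContinuousLinearMap.id ℝ (Vec p)).prod
        (-((e.symm : Vec m →L[ℝ] Vec m).comp (D.comp
          (ContinuousLinearMap.inl ℝ (Vec p) (Vec m))))))) M.Θ γ.1 := by
    have g1 : HasFDerivWithinAt (fun θ => M.G (θ, γ.2))
        (D.comp (ContinuousLinearMap.inl ℝ (Vec p) (Vec m))) M.Θ γ.1 :=
      ((hG.differentiableOn one_ne_zero γ ⟨h1, h2'⟩).hasFDerivWithinAt).comp (t := M.Θ ×ˢ M.𝒴) γ.1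
        (hasFDerivAt_prodMk_left γ.1 γ.2).hasFDerivWithinAt fun z hz => ⟨hz, h2'⟩
    have g2 := ((e.symm : Vec m →L[ℝ] Vec m).hasFDerivAt.comp_hasFDerivWithinAt γ.1
      g1).const_sub γ.2
    have g3 : HasFDerivWithinAt (fun θ => (θ, M.upsilon θ γ))
        ((ContinuousLinearMap.id ℝ (Vec p)).prod
        (-((e.symm : Vec m →L[ℝ] Vec m).comp (D.comp
          (ContinuousLinearMap.inl ℝ (Vec p) (Vec m)))))) M.Θ γ.1 := by
      simp only [hΥ]
      exact (hasFDerivWithinAt_id _ _).prodMk g2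
    have hpt : (γ.1, M.upsilon γ.1 γ) = γ := by
      rw [hΥ]
      simp [hγ]
    refine HasFDerivWithinAt.comp (t := M.Θ ×ˢ univ) γ.1 ?_ g3 fun z hz => ⟨hz, trivial⟩
    rwa [hpt]
  rw [hobj.fderivWithin (uniqueDiffOn_convex hΘ hΘn _ h1)]
  -- the derivative of the sample objective along the feasible curve
  have hφ : HasDerivWithinAt (fun t : ℝ => Q (γ.1 + t • h, c t))
      (DQ (h, -e.symm (D (h, 0)))) (Icc 0 1) 0 := by
    have hxt : HasDerivAt (fun t : ℝ => γ.1 + t • h) h 0 := by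
      simpa using ((hasDerivAt_id (0 : ℝ)).smul_const h).const_add γ.1
    refine HasFDerivWithinAt.comp_hasDerivWithinAt (t := M.Θ ×ˢ univ) 0 ?_
      (hxt.hasDerivWithinAt.prodMk hcd) fun t ht => ⟨hΘ.add_smul_mem h1 hin ht, trivial⟩
    simpa [hc0] using hQd
  have hloc : IsLocalMaxOn (fun t : ℝ => Q (γ.1 + t • h, c t)) (Icc 0 1) 0 := by
    filter_upwards [hcz, self_mem_nhdsWithin] with t ht ht1
    have := hmax (γ.1 + t • h, c t) ⟨hΘ.add_smul_mem h1 hin ht1, ht.1⟩ ht.2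
    simpa [hc0] using this
  have := hloc.hasFDerivWithinAt_nonpos hφ.hasFDerivWithinAt
    (y := 1) (mem_posTangentConeAt_of_segment_subset (by simp [segment_eq_Icc]))
  simpa using this

end FirstOrder


/-! ### The Newton-like update near the true parameter -/

section Update

variable {p m : ℕ} {𝒲 Ω : Type*} [MeasurableSpace 𝒲] [MeasurableSpace Ω] {M : Model p m 𝒲}
  {μ : Measure Ω} {w : ℕ → Ω → 𝒲}

/-- The point `(θ, Υ(θ, γ))` at which the iteration started at `γ` evaluates the objective. -/
noncomputable def Model.updatePt (M : Model p m 𝒲) (z : Vec p × Par p m) : Par p m :=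
  (z.1, M.upsilon z.1 z.2)

/-- The pair `(θ*, γ*)`, around which the iteration is studied as a map of `(θ, γ)`. -/
def Model.z₀ (M : Model p m 𝒲) : Vec p × Par p m := (M.γ₀.1, M.γ₀)

/-- The derivative at `z = (θ, γ)` of `θ ↦ (θ, Υ(θ, γ))`. -/
noncomputable def Model.updateDeriv (M : Model p m 𝒲) (z : Vec p × Par p m) :
    Vec p →L[ℝ] Par p m :=
  (fderiv ℝ M.updatePt z).comp (ContinuousLinearMap.inl ℝ (Vec p) (Par p m))

/-- On the closed ball of radius `r`, the constraint is regular and the update map is smooth with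
`C`-Lipschitz derivative; its derivative in `γ` vanishes at feasible points. -/
structure Model.IsRegularBall (M : Model p m 𝒲) (r C : ℝ) : Prop where
  pos : 0 < r
  pos' : 0 < C
  interior : Metric.closedBall M.γ₀ r ⊆ interior (M.Θ ×ˢ M.𝒴)
  invertible : ∀ γ ∈ Metric.closedBall M.γ₀ r, (M.jacY γ).IsInvertible
  differentiable : ∀ z ∈ Metric.closedBall M.z₀ r, DifferentiableAt ℝ M.updatePt z
  lipschitz : ∀ z₁ ∈ Metric.closedBall M.z₀ r, ∀ z₂ ∈ Metric.closedBall M.z₀ r,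
    ‖fderiv ℝ M.updatePt z₁ - fderiv ℝ M.updatePt z₂‖ ≤ C * ‖z₁ - z₂‖
  fderiv_inr : ∀ γ ∈ Metric.closedBall M.γ₀ r, M.G γ = 0 →
    (fderiv ℝ M.updatePt (γ.1, γ)).comp (ContinuousLinearMap.inr ℝ (Vec p) (Par p m)) = 0

theorem jacY_eq_of_mem_interior (hA : BasicAssumptions M μ w) {γ : Par p m}
    (hγ : γ ∈ interior (M.Θ ×ˢ M.𝒴)) :
    M.jacY γ = (fderiv ℝ M.G γ).comp (ContinuousLinearMap.inr ℝ (Vec p) (Vec m)) := by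
  have h := hγ
  rw [interior_prod_eq] at h
  rw [jacY_eq_comp_inr hA.convex_𝒴 (hA.G_contDiff.of_le (by norm_num)) (interior_subset h.1) h.2,
    fderivWithin_of_mem_nhds (mem_interior_iff_mem_nhds.1 hγ)]

theorem contDiffAt_G (hA : BasicAssumptions M μ w) {γ : Par p m}
    (hγ : γ ∈ interior (M.Θ ×ˢ M.𝒴)) : ContDiffAt ℝ 3 M.G γ :=
  hA.G_contDiff.contDiffAt (mem_interior_iff_mem_nhds.1 hγ)

theorem contDiffAt_jacY (hA : BasicAssumptions M μ w) {γ : Par p m}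
    (hγ : γ ∈ interior (M.Θ ×ˢ M.𝒴)) : ContDiffAt ℝ 2 M.jacY γ := by
  have h : M.jacY =ᶠ[𝓝 γ]
      fun γ => (fderiv ℝ M.G γ).comp (ContinuousLinearMap.inr ℝ (Vec p) (Vec m)) := by
    filter_upwards [isOpen_interior.mem_nhds hγ] with γ' hγ'
    exact jacY_eq_of_mem_interior hA hγ'
  refine ContDiffAt.congr_of_eventuallyEq ?_ h
  exact ((contDiffAt_G hA hγ).fderiv_right (by norm_num)).clm_comp contDiffAt_const

theorem contDiffAt_jacY_inverse (hA : BasicAssumptions M μ w) {γ : Par p m}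
    (hγ : γ ∈ interior (M.Θ ×ˢ M.𝒴)) (hJ : (M.jacY γ).IsInvertible) :
    ContDiffAt ℝ 2 (fun γ => (M.jacY γ).inverse) γ := by
  obtain ⟨e, he⟩ := hJ
  refine ContDiffAt.comp (g := ContinuousLinearMap.inverse) γ ?_ (contDiffAt_jacY hA hγ)
  rw [← he]
  exact contDiffAt_map_inverse e

theorem contDiffAt_updatePt (hA : BasicAssumptions M μ w) {z : Vec p × Par p m}
    (h1 : (z.1, z.2.2) ∈ interior (M.Θ ×ˢ M.𝒴)) (h2 : z.2 ∈ interior (M.Θ ×ˢ M.𝒴))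
    (hJ : (M.jacY z.2).IsInvertible) : ContDiffAt ℝ 2 M.updatePt z := by
  refine contDiffAt_fst.prodMk ?_
  have g1 : ContDiffAt ℝ 2 (fun z : Vec p × Par p m => M.G (z.1, z.2.2)) z :=
    ContDiffAt.comp z ((contDiffAt_G hA h1).of_le (by norm_num))
      (contDiffAt_fst.prodMk contDiffAt_snd.snd)
  have g2 : ContDiffAt ℝ 2 (fun z : Vec p × Par p m => (M.jacY z.2).inverse) z :=
    ContDiffAt.comp z (contDiffAt_jacY_inverse hA h2 hJ) contDiffAt_snd
  exact contDiffAt_snd.snd.sub (g2.clm_apply g1)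

theorem upsilon_of_constraint {γ : Par p m} (hγ : M.G γ = 0) : M.upsilon γ.1 γ = γ.2 := by
  simp [Model.upsilon, hγ]

theorem updatePt_of_constraint {γ : Par p m} (hγ : M.G γ = 0) : M.updatePt (γ.1, γ) = γ := by
  simp [Model.updatePt, upsilon_of_constraint hγ]

/-- The zero Jacobian property of a Newton step: at a feasible point the update does not depend on
its starting point to first order. -/
theorem hasFDerivAt_updatePt_snd (hA : BasicAssumptions M μ w) {γ : Par p m}
    (hγ : γ ∈ interior (M.Θ ×ˢ M.𝒴)) (hJ : (M.jacY γ).IsInvertible) (h0 : M.G γ = 0) :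
    HasFDerivAt (fun γ' => M.updatePt (γ.1, γ')) (0 : Par p m →L[ℝ] Par p m) γ := by
  have d1 := ((contDiffAt_jacY_inverse hA hγ hJ).differentiableAt two_ne_zero).hasFDerivAt
  have d2 : HasFDerivAt (fun γ' : Par p m => M.G (γ.1, γ'.2))
      ((M.jacY γ).comp (ContinuousLinearMap.snd ℝ (Vec p) (Vec m))) γ := by
    rw [jacY_eq_of_mem_interior hA hγ]
    have := ((contDiffAt_G hA hγ).differentiableAt three_ne_zero).hasFDerivAt
    exact (this.comp γ.2 (hasFDerivAt_prodMk_right γ.1 γ.2)).comp γ hasFDerivAt_snd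
  have d3 : HasFDerivAt (fun γ' : Par p m => M.upsilon γ.1 γ') (0 : Par p m →L[ℝ] Vec m) γ := by
    refine ((hasFDerivAt_snd (𝕜 := ℝ) (p := γ)).sub (d1.clm_apply d2)).congr_fderiv ?_
    obtain ⟨e, he⟩ := hJ
    ext v
    all_goals simp [h0, ← he]
  exact ((hasFDerivAt_const γ.1 γ).prodMk d3).congr_fderiv (by ext <;> simp)

theorem exists_isRegularBall (hA : BasicAssumptions M μ w) : ∃ r C, M.IsRegularBall r C := by
  have hint := isOpen_interior.mem_nhds hA.interior
  have c1 : Tendsto (fun z : Vec p × Par p m => (z.1, z.2.2)) (𝓝 M.z₀) (𝓝 M.γ₀) :=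
    (Continuous.tendsto (by fun_prop) M.z₀)
  have c2 : Tendsto (fun z : Vec p × Par p m => z.2) (𝓝 M.z₀) (𝓝 M.γ₀) :=
    (Continuous.tendsto (by fun_prop) M.z₀)
  have hJ : ∀ᶠ γ in 𝓝 M.γ₀, (M.jacY γ).IsInvertible := by
    obtain ⟨e, he⟩ := hA.jacY_invertible
    have := (contDiffAt_jacY hA hA.interior).continuousAt
    refine (this.eventually (he ▸ ContinuousLinearEquiv.nhds e)).mono ?_
    rintro γ ⟨e', he'⟩
    exact ⟨e', he'⟩
  have hsm : ∀ᶠ z in 𝓝 M.z₀, ContDiffAt ℝ 2 M.updatePt z := by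
    filter_upwards [c1.eventually hint, c2.eventually hint, c2.eventually hJ] with z h1 h2 h3
    exact contDiffAt_updatePt hA h1 h2 h3
  obtain ⟨K, t, ht, hK⟩ :=
    (hsm.self_of_nhds.fderiv_right (m := 1) (by norm_num)).exists_lipschitzOnWith
  obtain ⟨r₁, hr₁, h₁⟩ := Metric.nhds_basis_closedBall.eventually_iff.1
    (hJ.and hint)
  obtain ⟨r₂, hr₂, h₂⟩ := Metric.nhds_basis_closedBall.eventually_iff.1 (hsm.and ht)
  have hz : ∀ {r : ℝ}, ∀ γ ∈ Metric.closedBall M.γ₀ r, (γ.1, γ) ∈ Metric.closedBall M.z₀ r := by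
    intro r γ hγ
    rw [Metric.mem_closedBall, Prod.dist_eq] at hγ ⊢
    exact max_le ((le_max_left _ _).trans hγ) (by rw [Prod.dist_eq]; exact hγ)
  have hs1 := Metric.closedBall_subset_closedBall (x := M.γ₀) (min_le_left r₁ r₂)
  have hs2 := Metric.closedBall_subset_closedBall (x := M.z₀) (min_le_right r₁ r₂)
  refine ⟨min r₁ r₂, K + 1, lt_min hr₁ hr₂, by positivity, fun γ hγ => (h₁ (hs1 hγ)).2,
    fun γ hγ => (h₁ (hs1 hγ)).1, fun z hz => (h₂ (hs2 hz)).1.differentiableAt two_ne_zero, ?_, ?_⟩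
  · intro z₁ hz₁ z₂ hz₂
    have := hK.dist_le_mul _ (h₂ (hs2 hz₁)).2 _ (h₂ (hs2 hz₂)).2
    rw [dist_eq_norm, dist_eq_norm] at this
    nlinarith [norm_nonneg (z₁ - z₂)]
  · intro γ hγ h0
    have hd := ((h₂ (hs2 (hz γ hγ))).1.differentiableAt two_ne_zero).hasFDerivAt
    exact (hd.comp γ (hasFDerivAt_prodMk_right γ.1 γ)).unique
      (hasFDerivAt_updatePt_snd hA (h₁ (hs1 hγ)).2 (h₁ (hs1 hγ)).1 h0)

namespace Model.IsRegularBall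

variable {r C : ℝ}

theorem mono (hB : M.IsRegularBall r C) {r' : ℝ} (h0 : 0 < r') (h : r' ≤ r) :
    M.IsRegularBall r' C := by
  have h1 := Metric.closedBall_subset_closedBall (x := M.γ₀) h
  have h2 := Metric.closedBall_subset_closedBall (x := M.z₀) h
  exact ⟨h0, hB.pos', h1.trans hB.interior, fun γ hγ => hB.invertible γ (h1 hγ),
    fun z hz => hB.differentiable z (h2 hz),
    fun z₁ hz₁ z₂ hz₂ => hB.lipschitz z₁ (h2 hz₁) z₂ (h2 hz₂),
    fun γ hγ => hB.fderiv_inr γ (h1 hγ)⟩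

theorem hasFDerivAt_left (hB : M.IsRegularBall r C) {z : Vec p × Par p m}
    (hz : z ∈ Metric.closedBall M.z₀ r) :
    HasFDerivAt (fun θ => M.updatePt (θ, z.2)) (M.updateDeriv z) z.1 :=
  HasFDerivAt.comp (g := M.updatePt) z.1 (hB.differentiable z hz).hasFDerivAt
    (hasFDerivAt_prodMk_left z.1 z.2)

theorem norm_updateDeriv_sub_le (hB : M.IsRegularBall r C) {z₁ z₂ : Vec p × Par p m}
    (h₁ : z₁ ∈ Metric.closedBall M.z₀ r) (h₂ : z₂ ∈ Metric.closedBall M.z₀ r) :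
    ‖M.updateDeriv z₁ - M.updateDeriv z₂‖ ≤ C * ‖z₁ - z₂‖ := by
  rw [Model.updateDeriv, Model.updateDeriv, ← ContinuousLinearMap.sub_comp]
  calc _ ≤ _ := ContinuousLinearMap.opNorm_comp_le _ _
    _ ≤ (C * ‖z₁ - z₂‖) * 1 := mul_le_mul (hB.lipschitz _ h₁ _ h₂)
        (ContinuousLinearMap.norm_inl_le_one ℝ _ _) (norm_nonneg _)
        (mul_nonneg hB.pos'.le (norm_nonneg _))
    _ = _ := mul_one _

theorem self_mem (hB : M.IsRegularBall r C) : M.z₀ ∈ Metric.closedBall M.z₀ r :=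
  Metric.mem_closedBall_self hB.pos.le

theorem norm_updateDeriv_sub_center_le (hB : M.IsRegularBall r C) {z : Vec p × Par p m}
    (hz : z ∈ Metric.closedBall M.z₀ r) : ‖M.updateDeriv z - M.updateDeriv M.z₀‖ ≤ C * r := by
  refine (hB.norm_updateDeriv_sub_le hz hB.self_mem).trans ?_
  have := mem_closedBall_iff_norm.1 hz
  have := hB.pos'
  gcongr

/-- By the zero Jacobian property, the update is nearly linear in `θ` and nearly independent of
`γ`. -/
theorem norm_updatePt_sub_sub_le (hB : M.IsRegularBall r C) (h0 : M.G M.γ₀ = 0)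
    {z₁ z₂ : Vec p × Par p m} (h₁ : z₁ ∈ Metric.closedBall M.z₀ r)
    (h₂ : z₂ ∈ Metric.closedBall M.z₀ r) :
    ‖M.updatePt z₁ - M.updatePt z₂ - M.updateDeriv M.z₀ (z₁.1 - z₂.1)‖ ≤ C * r * ‖z₁ - z₂‖ := by
  have hD : fderiv ℝ M.updatePt M.z₀
      = (M.updateDeriv M.z₀).comp (ContinuousLinearMap.fst ℝ (Vec p) (Par p m)) := by
    have h := hB.fderiv_inr M.γ₀ (Metric.mem_closedBall_self hB.pos.le) h0
    refine ContinuousLinearMap.ext fun v => ?_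
    have e : v = (v.1, 0) + (0, v.2) := by simp
    have h' : fderiv ℝ M.updatePt M.z₀ (0, v.2) = 0 := by
      simpa [Model.z₀] using congrArg (fun L : Par p m →L[ℝ] Par p m => L v.2) h
    conv_lhs => rw [e, map_add, h', add_zero]
    simp [Model.updateDeriv]
  have := Convex.norm_image_sub_le_of_norm_hasFDerivWithin_le'
    (φ := fderiv ℝ M.updatePt M.z₀) (C := C * r)
    (fun z hz => (hB.differentiable z hz).hasFDerivAt.hasFDerivWithinAt) (fun z hz => ?_)
    (convex_closedBall M.z₀ r) h₂ h₁
  · simpa [hD] using this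
  · refine (hB.lipschitz z hz _ hB.self_mem).trans ?_
    have := mem_closedBall_iff_norm.1 hz
    have := hB.pos'
    gcongr

theorem prodMk_mem {θ : Vec p} {γ : Par p m} (hθ : θ ∈ Metric.closedBall M.γ₀.1 r)
    (hγ : γ ∈ Metric.closedBall M.γ₀ r) : (θ, γ) ∈ Metric.closedBall M.z₀ r := by
  rw [Metric.mem_closedBall, Prod.dist_eq]
  exact max_le hθ hγ

theorem fst_mem {γ : Par p m} (hγ : γ ∈ Metric.closedBall M.γ₀ r) :
    γ.1 ∈ Metric.closedBall M.γ₀.1 r := by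
  rw [Metric.mem_closedBall, Prod.dist_eq] at hγ
  exact (le_max_left _ _).trans hγ

/-- Newton's method converges quadratically. -/
theorem norm_updatePt_sub_le_sq (hB : M.IsRegularBall r C) {γ γ' : Par p m}
    (hγ : γ ∈ Metric.closedBall M.γ₀ r) (hγ' : γ' ∈ Metric.closedBall M.γ₀ r)
    (h0 : M.G γ = 0) : ‖M.updatePt (γ.1, γ') - γ‖ ≤ C * ‖γ' - γ‖ ^ 2 := by
  have hd : ∀ x ∈ segment ℝ γ γ', HasFDerivWithinAt (fun x => M.updatePt (γ.1, x))
      ((fderiv ℝ M.updatePt (γ.1, x)).comp (ContinuousLinearMap.inr ℝ (Vec p) (Par p m)))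
      (segment ℝ γ γ') x := by
    intro x hx
    have hx' := (convex_closedBall M.γ₀ r).segment_subset hγ hγ' hx
    exact (HasFDerivAt.comp (g := M.updatePt) x
      (hB.differentiable (γ.1, x) (prodMk_mem (fst_mem hγ) hx')).hasFDerivAt
      (hasFDerivAt_prodMk_right γ.1 x)).hasFDerivWithinAt
  have hb : ∀ x ∈ segment ℝ γ γ', ‖(fderiv ℝ M.updatePt (γ.1, x)).comp
      (ContinuousLinearMap.inr ℝ (Vec p) (Par p m))‖ ≤ C * ‖γ' - γ‖ := by
    intro x hx
    have hx' := (convex_closedBall M.γ₀ r).segment_subset hγ hγ' hx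
    have e : (fderiv ℝ M.updatePt (γ.1, x)).comp (ContinuousLinearMap.inr ℝ (Vec p) (Par p m))
        = (fderiv ℝ M.updatePt (γ.1, x) - fderiv ℝ M.updatePt (γ.1, γ)).comp
          (ContinuousLinearMap.inr ℝ (Vec p) (Par p m)) := by
      rw [ContinuousLinearMap.sub_comp, hB.fderiv_inr γ hγ h0, sub_zero]
    rw [e]
    have h1 := hB.lipschitz (γ.1, x) (prodMk_mem (fst_mem hγ) hx') (γ.1, γ)
      (prodMk_mem (fst_mem hγ) hγ)
    have h2 : ‖((γ.1, x) : Vec p × Par p m) - (γ.1, γ)‖ ≤ ‖γ' - γ‖ := by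
      have h3 : ‖x - γ‖ ≤ ‖γ' - γ‖ := by
        rw [segment_eq_image'] at hx
        obtain ⟨t, ht, rfl⟩ := hx
        simp only [add_sub_cancel_left, norm_smul, Real.norm_eq_abs, abs_of_nonneg ht.1]
        exact mul_le_of_le_one_left (norm_nonneg _) ht.2
      rw [Prod.norm_def]
      exact max_le (by simp) h3
    have hC := hB.pos'
    calc _ ≤ _ := ContinuousLinearMap.opNorm_comp_le _ _
      _ ≤ (C * ‖γ' - γ‖) * 1 := mul_le_mul (h1.trans (by gcongr))
          (ContinuousLinearMap.norm_inr_le_one ℝ _ _) (norm_nonneg _) (by positivity)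
      _ = _ := mul_one _
  have := Convex.norm_image_sub_le_of_norm_hasFDerivWithin_le hd hb (convex_segment γ γ')
    (left_mem_segment ℝ γ γ') (right_mem_segment ℝ γ γ')
  rw [updatePt_of_constraint h0] at this
  linarith

end Model.IsRegularBall

end Update


/-! ### The score of the iteration -/

section Score

variable {p m : ℕ} {𝒲 Ω : Type*} [MeasurableSpace 𝒲] [MeasurableSpace Ω] {M : Model p m 𝒲}
  {μ : Measure Ω} {w : ℕ → Ω → 𝒲}

/-- The derivative at `z = (θ, γ)` of `θ ↦ Q (θ, Υ(θ, γ))`. -/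
noncomputable def Model.stepScore (M : Model p m 𝒲) (Q : Par p m → ℝ) (z : Vec p × Par p m) :
    Vec p →L[ℝ] ℝ :=
  (fderiv ℝ Q (M.updatePt z)).comp (M.updateDeriv z)

/-- On the closed `ρ`-ball, the gradient of `Q` is the linear map `H` up to an `η`-Lipschitz
error. -/
def Model.HasNearlyLinearGradient (M : Model p m 𝒲) (Q : Par p m → ℝ)
    (H : Par p m →L[ℝ] Par p m →L[ℝ] ℝ) (η ρ : ℝ) : Prop :=
  ∀ a₁ ∈ Metric.closedBall M.γ₀ ρ, ∀ a₂ ∈ Metric.closedBall M.γ₀ ρ,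
    ‖fderiv ℝ Q a₁ - fderiv ℝ Q a₂ - H (a₁ - a₂)‖ ≤ η * ‖a₁ - a₂‖

/-- The properties of an objective `Q` near the true parameter on which the behaviour of the
iteration rests. -/
structure Model.IsGoodObjective (M : Model p m 𝒲) (Q : Par p m → ℝ) (κ C r : ℝ) : Prop where
  hasFDerivAt : ∀ z ∈ Metric.closedBall M.z₀ r,
    HasFDerivAt (fun θ => Q (θ, M.upsilon θ z.2)) (M.stepScore Q z) z.1
  solve : ∀ z₁ ∈ Metric.closedBall M.z₀ r, ∀ z₂ ∈ Metric.closedBall M.z₀ r,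
    M.stepScore Q z₁ = 0 → M.stepScore Q z₂ = 0 →
    ‖z₁.1 - z₂.1‖ ≤ κ * ‖z₁.2 - z₂.2‖ ∧ ‖M.updatePt z₁ - M.updatePt z₂‖ ≤ κ * ‖z₁.2 - z₂.2‖
  exists_root : ∀ γ ∈ Metric.closedBall M.γ₀ (r / 2), ∃ θ ∈ Metric.closedBall M.γ₀.1 r,
    M.stepScore Q (θ, γ) = 0
  rate : ∀ γ ∈ Metric.closedBall M.γ₀ r, M.G γ = 0 → M.stepScore Q (γ.1, γ) = 0 →
    ∀ γ' ∈ Metric.closedBall M.γ₀ r, ∀ θ ∈ Metric.closedBall M.γ₀.1 r,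
      M.stepScore Q (θ, γ') = 0 →
      ‖M.updatePt (θ, γ') - γ‖ ≤ C * (‖fderiv ℝ Q M.γ₀‖ * ‖γ' - γ‖ + ‖γ' - γ‖ ^ 2)

set_option maxHeartbeats 1000000 in
/-- If the gradient of `Q` is nearly linear around the true parameter and small at it, with the
curvature `H` invertible along the tangent of the constraint set, then `Q` is good there, with an
arbitrarily small contraction constant `κ`. -/
theorem exists_isGoodObjective (hA : BasicAssumptions M μ w)
    (H : Par p m →L[ℝ] Par p m →L[ℝ] ℝ) (S : Vec p ≃L[ℝ] (Vec p →L[ℝ] ℝ))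
    (hS : ∀ u, S u = (H (M.updateDeriv M.z₀ u)).comp (M.updateDeriv M.z₀))
    {κ : ℝ} (hκ : 0 < κ) (hκ1 : κ ≤ 1 / 2) :
    ∃ η > 0, ∀ ρ > 0, ∃ r > 0, ∃ C > 0, ∃ τ > 0,
      Metric.closedBall M.γ₀ r ⊆ interior (M.Θ ×ˢ M.𝒴) ∧
      (∀ γ ∈ Metric.closedBall M.γ₀ r, (M.jacY γ).IsInvertible) ∧
      ∀ Q : Par p m → ℝ, DifferentiableOn ℝ Q (M.Θ ×ˢ univ) →
        M.HasNearlyLinearGradient Q H η ρ → ‖fderiv ℝ Q M.γ₀‖ ≤ τ →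
        M.IsGoodObjective Q κ C r := by
  obtain ⟨rg, Cg, hB⟩ := exists_isRegularBall hA
  have hCg := hB.pos'
  set A₀ := M.updateDeriv M.z₀ with hA₀
  obtain ⟨C₁, hC₁, η₁, hη₁, hsolve⟩ := exists_score_solve_bound S A₀ hκ
  set R := posRightInverse S
  have hR : 0 < (R.nnnorm : ℝ) := posRightInverse_nnnorm_pos S
  set k : ℝ := (R.nnnorm : ℝ)⁻¹ / 2 with hk
  have hk0 : 0 < k := by positivity
  set a : ℝ := ‖A₀‖ + 1 with ha
  set h : ℝ := ‖H‖ + 1 with hh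
  have ha1 : 1 ≤ a := by have := norm_nonneg A₀; linarith
  have hh1 : 1 ≤ h := by have := norm_nonneg H; linarith
  set C' : ℝ := (‖A₀‖ + 1) ^ 2 + ‖H‖ * (‖A₀‖ + 1) + ‖H‖ * ‖A₀‖ + Cg with hC'
  have hC'1 : 1 ≤ C' := by
    have : 1 ≤ (‖A₀‖ + 1) ^ 2 := by nlinarith
    have : 0 ≤ ‖H‖ * (‖A₀‖ + 1) + ‖H‖ * ‖A₀‖ := by positivity
    linarith
  set η : ℝ := min 1 (min η₁ k / C') with hη
  have hη0 : 0 < η := by positivity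
  have hη_one : η ≤ 1 := min_le_left _ _
  have hCη : C' * η ≤ min η₁ k := by
    have : η ≤ min η₁ k / C' := min_le_right _ _
    rwa [le_div_iff₀' (by positivity)] at this
  have hηη : η ≤ min η₁ k := by nlinarith
  refine ⟨η, hη0, fun ρ hρ => ?_⟩
  -- on the `r`-ball the update is `η`-close to linear and stays in the balls where the gradient is
  -- controlled, and the gradient varies by at most `η / 2` along it
  set r : ℝ := min rg (min (η / Cg) (min (min ρ rg / a) (η / (2 * (h * a))))) with hr
  have hrg0 := hB.pos
  have hr0 : 0 < r := by positivity
  have hr1 : r ≤ rg := min_le_left _ _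
  have hr2 : Cg * r ≤ η := by
    have : r ≤ η / Cg := (min_le_right _ _).trans (min_le_left _ _)
    rwa [le_div_iff₀' hCg] at this
  have hr3 : a * r ≤ min ρ rg := by
    have : r ≤ min ρ rg / a :=
      (min_le_right _ _).trans ((min_le_right _ _).trans (min_le_left _ _))
    rwa [le_div_iff₀' (by positivity)] at this
  have hr4 : h * (a * r) ≤ η / 2 := by
    have : r ≤ η / (2 * (h * a)) :=
      (min_le_right _ _).trans ((min_le_right _ _).trans (min_le_right _ _))
    rw [le_div_iff₀' (by positivity)] at this
    linarith
  have hBr := hB.mono hr0 hr1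
  refine ⟨r, hr0, C₁ * (h * Cg * a) + C₁ * ((1 + 2 * h * C₁ * a) * Cg) + Cg, by positivity,
    min (η / 2) (k * r / (2 * a)), by positivity, hBr.interior, hBr.invertible, ?_⟩
  intro Q hQ hH hτ
  have hτ1 : ‖fderiv ℝ Q M.γ₀‖ ≤ η / 2 := hτ.trans (min_le_left _ _)
  have hτ2 : a * ‖fderiv ℝ Q M.γ₀‖ ≤ k * r / 2 := by
    have : ‖fderiv ℝ Q M.γ₀‖ ≤ k * r / (2 * a) := hτ.trans (min_le_right _ _)
    rw [le_div_iff₀' (by positivity)] at this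
    linarith
  have hz₀ : M.updatePt M.z₀ = M.γ₀ := updatePt_of_constraint hA.constraint
  have hΨ : ∀ z₁ ∈ Metric.closedBall M.z₀ r, ∀ z₂ ∈ Metric.closedBall M.z₀ r,
      ‖M.updatePt z₁ - M.updatePt z₂ - A₀ (z₁.1 - z₂.1)‖ ≤ η * ‖z₁ - z₂‖ := by
    intro z₁ h₁ z₂ h₂
    refine (hBr.norm_updatePt_sub_sub_le hA.constraint h₁ h₂).trans ?_
    gcongr
  have hΨar : ∀ z ∈ Metric.closedBall M.z₀ r, ‖M.updatePt z - M.γ₀‖ ≤ a * r := by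
    intro z hz
    have t := norm_add_le (M.updatePt z - M.updatePt M.z₀ - A₀ (z.1 - M.z₀.1)) (A₀ (z.1 - M.z₀.1))
    rw [sub_add_cancel, hz₀] at t
    have t1 := hΨ z hz _ hBr.self_mem
    have t2 : ‖z - M.z₀‖ ≤ r := mem_closedBall_iff_norm.1 hz
    have t3 : ‖A₀ (z.1 - M.z₀.1)‖ ≤ ‖A₀‖ * r :=
      (A₀.le_opNorm _).trans (by gcongr; exact (norm_fst_le (z - M.z₀)).trans t2)
    rw [hz₀] at t1
    have : η * ‖z - M.z₀‖ ≤ 1 * r := by gcongr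
    rw [ha]
    linarith
  have hΨρ : ∀ z ∈ Metric.closedBall M.z₀ r, M.updatePt z ∈ Metric.closedBall M.γ₀ ρ := fun z hz =>
    mem_closedBall_iff_norm.2 ((hΨar z hz).trans (hr3.trans (min_le_left _ _)))
  have hΨint : ∀ z ∈ Metric.closedBall M.z₀ r, M.updatePt z ∈ interior (M.Θ ×ˢ M.𝒴) := fun z hz =>
    hB.interior (mem_closedBall_iff_norm.2 ((hΨar z hz).trans (hr3.trans (min_le_right _ _))))
  have hγρ : Metric.closedBall M.γ₀ r ⊆ Metric.closedBall M.γ₀ ρ :=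
    Metric.closedBall_subset_closedBall
      ((by nlinarith : r ≤ a * r).trans (hr3.trans (min_le_left _ _)))
  have hcρ : M.γ₀ ∈ Metric.closedBall M.γ₀ ρ := Metric.mem_closedBall_self hρ.le
  -- the gradient is Lipschitz with constant `h` and small near the true parameter
  have hDL : ∀ a₁ ∈ Metric.closedBall M.γ₀ ρ, ∀ a₂ ∈ Metric.closedBall M.γ₀ ρ,
      ‖fderiv ℝ Q a₁ - fderiv ℝ Q a₂‖ ≤ h * ‖a₁ - a₂‖ := by
    intro a₁ h₁ a₂ h₂
    have t := norm_add_le (fderiv ℝ Q a₁ - fderiv ℝ Q a₂ - H (a₁ - a₂)) (H (a₁ - a₂))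
    rw [sub_add_cancel] at t
    have t1 := hH a₁ h₁ a₂ h₂
    have t2 := H.le_opNorm (a₁ - a₂)
    have : η * ‖a₁ - a₂‖ ≤ 1 * ‖a₁ - a₂‖ := by gcongr
    rw [hh]
    linarith
  have hD0 : ∀ a₁ ∈ Metric.closedBall M.γ₀ ρ,
      ‖fderiv ℝ Q a₁‖ ≤ ‖fderiv ℝ Q M.γ₀‖ + h * ‖a₁ - M.γ₀‖ := by
    intro a₁ h₁
    have t := norm_add_le (fderiv ℝ Q a₁ - fderiv ℝ Q M.γ₀) (fderiv ℝ Q M.γ₀)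
    rw [sub_add_cancel] at t
    linarith [hDL a₁ h₁ _ hcρ]
  have hDη : ∀ z ∈ Metric.closedBall M.z₀ r, ‖fderiv ℝ Q (M.updatePt z)‖ ≤ η := by
    intro z hz
    have : h * ‖M.updatePt z - M.γ₀‖ ≤ h * (a * r) := by gcongr; exact hΨar z hz
    linarith [hD0 _ (hΨρ z hz)]
  have hF : ∀ z₁ ∈ Metric.closedBall M.z₀ r, ∀ z₂ ∈ Metric.closedBall M.z₀ r,
      ‖M.stepScore Q z₁ - M.stepScore Q z₂ - S (z₁.1 - z₂.1)‖ ≤ min η₁ k * ‖z₁ - z₂‖ := by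
    intro z₁ h₁ z₂ h₂
    rw [hS]
    refine (norm_score_sub_sub_le (D := fderiv ℝ Q) (Ψ := M.updatePt) (A := M.updateDeriv)
      hη_one (hH _ (hΨρ z₁ h₁) _ (hΨρ z₂ h₂)) (hDη z₂ h₂) (hΨ z₁ h₁ z₂ h₂)
      (hBr.norm_updateDeriv_sub_le h₁ h₂)
      ((hBr.norm_updateDeriv_sub_center_le h₁).trans hr2)).trans ?_
    gcongr
  have hsol := hsolve (Metric.closedBall M.z₀ r) (M.stepScore Q) M.updatePt
    (fun z₁ h₁ z₂ h₂ => (hF z₁ h₁ z₂ h₂).trans (by gcongr; exact min_le_left _ _))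
    (fun z₁ h₁ z₂ h₂ => (hΨ z₁ h₁ z₂ h₂).trans (by gcongr; exact hηη.trans (min_le_left _ _)))
  have hF0 : ‖M.stepScore Q M.z₀‖ ≤ a * ‖fderiv ℝ Q M.γ₀‖ := by
    rw [Model.stepScore, hz₀]
    refine (ContinuousLinearMap.opNorm_comp_le _ _).trans ?_
    rw [mul_comm]
    gcongr
    linarith
  refine ⟨?_, ?_, ?_, ?_⟩
  · intro z hz
    have hzi := hΨint z hz
    have hQd : HasFDerivAt Q (fderiv ℝ Q (M.updatePt z)) (M.updatePt z) := by
      refine (hQ.differentiableAt ?_).hasFDerivAt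
      exact mem_of_superset (mem_interior_iff_mem_nhds.1 hzi) (prod_mono_right (subset_univ _))
    exact HasFDerivAt.comp (g := Q) (f := fun θ => M.updatePt (θ, z.2)) z.1 hQd
      (hBr.hasFDerivAt_left hz)
  · intro z₁ h₁ z₂ h₂ e₁ e₂
    simpa [e₁, e₂] using hsol z₁ h₁ z₂ h₂
  · intro γ hγ
    have hγr : γ ∈ Metric.closedBall M.γ₀ r :=
      Metric.closedBall_subset_closedBall (by linarith) hγ
    have happ : ApproximatesLinearOn (fun θ => M.stepScore Q (θ, γ))
        (S : Vec p →L[ℝ] (Vec p →L[ℝ] ℝ)) (Metric.closedBall M.γ₀.1 r) ⟨k, hk0.le⟩ := by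
      intro θ₁ h₁ θ₂ h₂
      have t := hF (θ₁, γ) (Model.IsRegularBall.prodMk_mem h₁ hγr) (θ₂, γ)
        (Model.IsRegularBall.prodMk_mem h₂ hγr)
      have e : ‖((θ₁, γ) : Vec p × Par p m) - (θ₂, γ)‖ = ‖θ₁ - θ₂‖ := by
        simp [Prod.norm_def]
      rw [e] at t
      refine t.trans ?_
      change _ ≤ k * ‖θ₁ - θ₂‖
      gcongr
      exact min_le_right _ _
    obtain ⟨θ, hθ, h0⟩ := happ.surjOn_closedBall_of_nonlinearRightInverse R hr0.le subset_rfl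
      (a := 0) (by
        rw [mem_closedBall_iff_norm', sub_zero]
        change ‖M.stepScore Q (M.γ₀.1, γ)‖ ≤ ((R.nnnorm : ℝ)⁻¹ - k) * r
        have hzm : (M.γ₀.1, γ) ∈ Metric.closedBall M.z₀ r :=
          Model.IsRegularBall.prodMk_mem (Metric.mem_closedBall_self hr0.le) hγr
        have t := hF (M.γ₀.1, γ) hzm _ hBr.self_mem
        have e : ‖((M.γ₀.1, γ) : Vec p × Par p m) - M.z₀‖ = ‖γ - M.γ₀‖ := by
          simp [Prod.norm_def, Model.z₀]
        have e' : ((M.γ₀.1, γ) : Vec p × Par p m).1 - M.z₀.1 = 0 := by simp [Model.z₀]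
        rw [e, e', map_zero, sub_zero] at t
        have t2 := norm_add_le (M.stepScore Q (M.γ₀.1, γ) - M.stepScore Q M.z₀)
          (M.stepScore Q M.z₀)
        rw [sub_add_cancel] at t2
        have t3 : min η₁ k * ‖γ - M.γ₀‖ ≤ k * (r / 2) := by
          gcongr
          · exact min_le_right _ _
          · exact mem_closedBall_iff_norm.1 hγ
        have e2 : (R.nnnorm : ℝ)⁻¹ = 2 * k := by rw [hk]; ring
        rw [e2]
        linarith)
    exact ⟨θ, hθ, h0⟩
  · intro γ hγ hGγ hγ0 γ' hγ' θ hθ hθ0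
    set d₀ := ‖fderiv ℝ Q M.γ₀‖ with hd₀
    set δ := ‖γ' - γ‖ with hδ
    have hzh : (γ.1, γ) ∈ Metric.closedBall M.z₀ r :=
      Model.IsRegularBall.prodMk_mem (Model.IsRegularBall.fst_mem hγ) hγ
    have hz2 : (γ.1, γ') ∈ Metric.closedBall M.z₀ r :=
      Model.IsRegularBall.prodMk_mem (Model.IsRegularBall.fst_mem hγ) hγ'
    have hz1 : (θ, γ') ∈ Metric.closedBall M.z₀ r := Model.IsRegularBall.prodMk_mem hθ hγ'
    have hΨh : M.updatePt (γ.1, γ) = γ := updatePt_of_constraint hGγ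
    -- the estimate is within a multiple of the score of the true parameter
    have s1 : ‖γ - M.γ₀‖ ≤ 2 * C₁ * a * d₀ := by
      have t := (hsol (γ.1, γ) hzh M.z₀ hBr.self_mem).2
      rw [hΨh, hz₀, hγ0, zero_sub, norm_neg] at t
      change _ ≤ C₁ * ‖M.stepScore Q M.z₀‖ + κ * ‖γ - M.γ₀‖ at t
      have : κ * ‖γ - M.γ₀‖ ≤ 1 / 2 * ‖γ - M.γ₀‖ := by gcongr
      have : C₁ * ‖M.stepScore Q M.z₀‖ ≤ C₁ * (a * d₀) := by gcongr
      linarith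
    have s2 : ‖fderiv ℝ Q γ‖ ≤ (1 + 2 * h * C₁ * a) * d₀ := by
      have t := hD0 γ (hγρ hγ)
      have : h * ‖γ - M.γ₀‖ ≤ h * (2 * C₁ * a * d₀) := by gcongr
      linarith
    have s3 : ‖M.updatePt (γ.1, γ') - γ‖ ≤ Cg * δ ^ 2 :=
      hBr.norm_updatePt_sub_le_sq hγ hγ' hGγ
    have s4 : ‖M.stepScore Q (γ.1, γ')‖ ≤ h * (Cg * δ ^ 2) * a
        + (1 + 2 * h * C₁ * a) * d₀ * (Cg * δ) := by
      have e : M.stepScore Q (γ.1, γ') = (fderiv ℝ Q (M.updatePt (γ.1, γ')) - fderiv ℝ Q γ).comp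
          (M.updateDeriv (γ.1, γ')) + (fderiv ℝ Q γ).comp
            (M.updateDeriv (γ.1, γ') - M.updateDeriv (γ.1, γ)) := by
        have := hγ0
        rw [Model.stepScore, hΨh] at this
        rw [ContinuousLinearMap.comp_sub, this, sub_zero, ContinuousLinearMap.sub_comp,
          sub_add_cancel, Model.stepScore]
      rw [e]
      refine (norm_add_le _ _).trans (add_le_add ?_ ?_)
      · refine (ContinuousLinearMap.opNorm_comp_le _ _).trans
          (mul_le_mul ((hDL _ (hΨρ _ hz2) _ (hγρ hγ)).trans (by gcongr)) ?_ (norm_nonneg _)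
            (by positivity))
        have t := norm_add_le (M.updateDeriv (γ.1, γ') - A₀) A₀
        rw [sub_add_cancel] at t
        linarith [hBr.norm_updateDeriv_sub_center_le hz2]
      · refine (ContinuousLinearMap.opNorm_comp_le _ _).trans
          (mul_le_mul s2 ((hBr.norm_updateDeriv_sub_le hz2 hzh).trans (le_of_eq ?_))
            (norm_nonneg _) (by positivity))
        simp [Prod.norm_def, hδ]
    have s5 : ‖M.updatePt (θ, γ') - M.updatePt (γ.1, γ')‖ ≤ C₁ * ‖M.stepScore Q (γ.1, γ')‖ := by
      have t := (hsol (θ, γ') hz1 (γ.1, γ') hz2).2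
      simpa [hθ0] using t
    have s6 := norm_add_le (M.updatePt (θ, γ') - M.updatePt (γ.1, γ'))
      (M.updatePt (γ.1, γ') - γ)
    rw [sub_add_sub_cancel] at s6
    have s7 : C₁ * ‖M.stepScore Q (γ.1, γ')‖ ≤ C₁ * (h * (Cg * δ ^ 2) * a
        + (1 + 2 * h * C₁ * a) * d₀ * (Cg * δ)) := by gcongr
    have p1 : 0 ≤ C₁ * (h * Cg * a) * (d₀ * δ) := by positivity
    have p2 : 0 ≤ C₁ * ((1 + 2 * h * C₁ * a) * Cg) * δ ^ 2 := by positivity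
    have p3 : 0 ≤ Cg * (d₀ * δ) := by positivity
    linarith

end Score


/-! ### The iteration in a given sample -/

section Sample

variable {p m : ℕ} {𝒲 Ω : Type*} [MeasurableSpace 𝒲] [MeasurableSpace Ω] {M : Model p m 𝒲}
  {μ : Measure Ω} {w : ℕ → Ω → 𝒲}

theorem contDiffOn_sampleQ (hA : BasicAssumptions M μ w) (x : ℕ → 𝒲) (N : ℕ) :
    ContDiffOn ℝ 2 (M.sampleQ x N) (M.Θ ×ˢ univ) :=
  contDiffOn_const.mul (ContDiffOn.sum fun i _ => hA.logLik_contDiff (x i))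

theorem interior_Θ_nonempty (hA : BasicAssumptions M μ w) : (interior M.Θ).Nonempty := by
  have := hA.interior
  rw [interior_prod_eq] at this
  exact ⟨_, this.1⟩

theorem mle_isFirstOrderPoint (hA : BasicAssumptions M μ w) {x : ℕ → 𝒲} {N : ℕ} {γ : Par p m}
    (hγ : M.IsMLE x N γ) (h2 : γ.2 ∈ interior M.𝒴) (hJ : (M.jacY γ).IsInvertible) :
    IsFirstOrderPoint (M.stepObj x N γ) M.Θ γ.1 :=
  IsFirstOrderPoint.of_constrained_max hA.convex_Θ hA.convex_𝒴 (interior_Θ_nonempty hA)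
    (hA.G_contDiff.of_le (by norm_num))
    ((contDiffOn_sampleQ hA x N).differentiableOn two_ne_zero) hγ.1.1 h2 hγ.2.1 hJ hγ.2.2

theorem mle_isEPLStep_iff (hA : BasicAssumptions M μ w) {x : ℕ → 𝒲} {N : ℕ} {γ : Par p m}
    (hγ : M.IsMLE x N γ) (h2 : γ.2 ∈ interior M.𝒴) (hJ : (M.jacY γ).IsInvertible)
    (hU : M.HasUniqueSolution x N γ) (γ' : Par p m) : M.IsEPLStep x N γ γ' ↔ γ' = γ := by
  have hmax := hU.2 _ (mle_isFirstOrderPoint hA hγ h2 hJ)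
  constructor
  · rintro ⟨_, h3, h4, h5⟩
    have h6 : γ'.1 = γ.1 := hU.1.unique ⟨h3, h4⟩ ⟨hγ.1.1, hmax⟩
    rw [h6, upsilon_of_constraint hγ.2.1] at h5
    exact Prod.ext h6 h5
  · rintro rfl
    exact ⟨hJ, hγ.1.1, hmax, (upsilon_of_constraint hγ.2.1).symm⟩

theorem IsFirstOrderPoint.eq_zero {d : ℕ} {f : Vec d → ℝ} {s : Set (Vec d)} {θ : Vec d}
    {L : Vec d →L[ℝ] ℝ} (h : IsFirstOrderPoint f s θ) (hθ : θ ∈ interior s)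
    (hf : HasFDerivAt f L θ) : L = 0 := by
  have hs := mem_interior_iff_mem_nhds.1 hθ
  have hL : ∀ v, L v ≤ 0 := by
    intro v
    have h1 : Tendsto (fun t : ℝ => θ + t • v) (𝓝[>] 0) (𝓝 θ) := by
      have : Continuous fun t : ℝ => θ + t • v := by fun_prop
      simpa using (this.tendsto 0).mono_left nhdsWithin_le_nhds
    obtain ⟨t, ht, ht0⟩ := ((h1.eventually hs).and self_mem_nhdsWithin).exists
    have h2 := h.2 _ ht
    rw [fderivWithin_of_mem_nhds hs, hf.fderiv, add_sub_cancel_left, map_smul, smul_eq_mul] at h2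
    exact nonpos_of_mul_nonpos_right h2 ht0
  ext v
  refine le_antisymm (hL v) ?_
  have := hL (-v)
  rw [map_neg] at this
  simpa using this

theorem isFirstOrderPoint_of_hasFDerivAt_zero {d : ℕ} {f : Vec d → ℝ} {s : Set (Vec d)} {θ : Vec d}
    (hθ : θ ∈ interior s) (hf : HasFDerivAt f (0 : Vec d →L[ℝ] ℝ) θ) :
    IsFirstOrderPoint f s θ := by
  refine ⟨interior_subset hθ, fun θ' _ => ?_⟩
  rw [fderivWithin_of_mem_nhds (mem_interior_iff_mem_nhds.1 hθ), hf.fderiv]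
  simp

theorem mem_interior_Θ {r : ℝ} (hr : Metric.closedBall M.γ₀ r ⊆ interior (M.Θ ×ˢ M.𝒴))
    {θ : Vec p} (hθ : θ ∈ Metric.closedBall M.γ₀.1 r) : θ ∈ interior M.Θ := by
  have h : (θ, M.γ₀.2) ∈ Metric.closedBall M.γ₀ r := by
    rw [Metric.mem_closedBall, Prod.dist_eq]
    exact max_le hθ (by simpa using dist_nonneg.trans (Metric.mem_closedBall.1 hθ))
  have := hr h
  rw [interior_prod_eq] at this
  exact this.1

theorem mem_interior_𝒴 {r : ℝ} (hr : Metric.closedBall M.γ₀ r ⊆ interior (M.Θ ×ˢ M.𝒴))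
    {γ : Par p m} (hγ : γ ∈ Metric.closedBall M.γ₀ r) : γ.2 ∈ interior M.𝒴 := by
  have := hr hγ
  rw [interior_prod_eq] at this
  exact this.2

namespace Model.IsGoodObjective

variable {x : ℕ → 𝒲} {N : ℕ} {κ C r : ℝ}

theorem stepScore_mle (hA : BasicAssumptions M μ w) (hg : M.IsGoodObjective (M.sampleQ x N) κ C r)
    (hr : Metric.closedBall M.γ₀ r ⊆ interior (M.Θ ×ˢ M.𝒴))
    (hJ : ∀ γ ∈ Metric.closedBall M.γ₀ r, (M.jacY γ).IsInvertible) {γ : Par p m}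
    (hγ : γ ∈ Metric.closedBall M.γ₀ r) (hmle : M.IsMLE x N γ) :
    M.stepScore (M.sampleQ x N) (γ.1, γ) = 0 :=
  (mle_isFirstOrderPoint hA hmle (mem_interior_𝒴 hr hγ) (hJ γ hγ)).eq_zero
    (mem_interior_Θ hr (IsRegularBall.fst_mem hγ))
    (hg.hasFDerivAt (γ.1, γ) (IsRegularBall.prodMk_mem (IsRegularBall.fst_mem hγ) hγ))

/-- The maximizer of an iteration with a unique solution is the root of the score near the true
parameter: that root satisfies the first-order conditions. -/
theorem step_eq (hg : M.IsGoodObjective (M.sampleQ x N) κ C r)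
    (hr : Metric.closedBall M.γ₀ r ⊆ interior (M.Θ ×ˢ M.𝒴)) {γ γ' : Par p m}
    (hγ : γ ∈ Metric.closedBall M.γ₀ (r / 2)) (hγr : γ ∈ Metric.closedBall M.γ₀ r)
    (hU : M.HasUniqueSolution x N γ) (hs : M.IsEPLStep x N γ γ') :
    γ'.1 ∈ Metric.closedBall M.γ₀.1 r ∧ M.stepScore (M.sampleQ x N) (γ'.1, γ) = 0 ∧
      γ' = M.updatePt (γ'.1, γ) := by
  obtain ⟨θ, hθ, h0⟩ := hg.exists_root γ hγ
  have hd := hg.hasFDerivAt (θ, γ) (IsRegularBall.prodMk_mem hθ hγr)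
  rw [h0] at hd
  have hθi := mem_interior_Θ hr hθ
  have hmax := hU.2 θ (isFirstOrderPoint_of_hasFDerivAt_zero hθi hd)
  have he : θ = γ'.1 := hU.1.unique ⟨interior_subset hθi, hmax⟩ ⟨hs.2.1, hs.2.2.1⟩
  subst he
  exact ⟨hθ, h0, Prod.ext rfl hs.2.2.2⟩

theorem norm_step_sub_mle_le (hA : BasicAssumptions M μ w)
    (hg : M.IsGoodObjective (M.sampleQ x N) κ C r)
    (hr : Metric.closedBall M.γ₀ r ⊆ interior (M.Θ ×ˢ M.𝒴))
    (hJ : ∀ γ ∈ Metric.closedBall M.γ₀ r, (M.jacY γ).IsInvertible) (hr0 : 0 < r)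
    {γm γ γ' : Par p m} (hγm : γm ∈ Metric.closedBall M.γ₀ r) (hmle : M.IsMLE x N γm)
    (hγ : γ ∈ Metric.closedBall M.γ₀ (r / 2)) (hU : M.HasUniqueSolution x N γ)
    (hs : M.IsEPLStep x N γ γ') :
    ‖γ' - γm‖ ≤ C * (‖fderiv ℝ (M.sampleQ x N) M.γ₀‖ * ‖γ - γm‖ + ‖γ - γm‖ ^ 2) := by
  have hγr : γ ∈ Metric.closedBall M.γ₀ r :=
    Metric.closedBall_subset_closedBall (by linarith) hγ
  obtain ⟨h1, h2, h3⟩ := hg.step_eq hr hγ hγr hU hs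
  rw [h3]
  exact hg.rate γm hγm hmle.2.1 (hg.stepScore_mle hA hr hJ hγm hmle) γ hγr _ h1 h2

end Model.IsGoodObjective

theorem continuousOn_stepObj (hA : BasicAssumptions M μ w) (x : ℕ → 𝒲) (N : ℕ) {s : Set (Par p m)}
    (hs : s ⊆ interior (M.Θ ×ˢ M.𝒴)) (hJ : ∀ γ ∈ s, (M.jacY γ).IsInvertible) :
    ContinuousOn (fun q : Par p m × Vec p => M.stepObj x N q.1 q.2) (s ×ˢ M.Θ) := by
  have hinv : ContinuousOn (fun q : Par p m × Vec p => (M.jacY q.1).inverse) (s ×ˢ M.Θ) := by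
    have : ContinuousOn (fun γ => (M.jacY γ).inverse) s := fun γ hγ =>
      (contDiffAt_jacY_inverse hA (hs hγ) (hJ γ hγ)).continuousAt.continuousWithinAt
    exact this.comp continuousOn_fst fun q hq => hq.1
  have hG : ContinuousOn (fun q : Par p m × Vec p => M.G (q.2, q.1.2)) (s ×ˢ M.Θ) :=
    hA.G_contDiff.continuousOn.comp (by fun_prop)
      fun q hq => ⟨hq.2, (interior_subset (hs hq.1)).2⟩
  have hΥ : ContinuousOn (fun q : Par p m × Vec p => M.upsilon q.2 q.1) (s ×ˢ M.Θ) :=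
    (by fun_prop : ContinuousOn (fun q : Par p m × Vec p => q.1.2) (s ×ˢ M.Θ)).sub
      (hinv.clm_apply hG)
  exact (contDiffOn_sampleQ hA x N).continuousOn.comp (continuousOn_snd.prodMk hΥ)
    fun q hq => ⟨hq.2, trivial⟩

/-- Around an estimate at which the iteration has a unique solution the iteration is a contraction.
Maximizers of the objective at nearby starting points stay near the true parameter, by compactness
of `Θ`; there the score has only one root, which depends on the starting point in a `κ`-Lipschitz
way. -/
theorem exists_contraction (hA : BasicAssumptions M μ w) {x : ℕ → 𝒲} {N : ℕ} {C r : ℝ} {κ : ℝ≥0}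
    (hg : M.IsGoodObjective (M.sampleQ x N) κ C r) (hκ : κ < 1)
    (hr : Metric.closedBall M.γ₀ r ⊆ interior (M.Θ ×ˢ M.𝒴))
    (hJ : ∀ γ ∈ Metric.closedBall M.γ₀ r, (M.jacY γ).IsInvertible)
    {γm : Par p m} (hγm : γm ∈ Metric.ball M.γ₀ r) (hmle : M.IsMLE x N γm)
    (hU : M.HasUniqueSolution x N γm) :
    ∃ B ∈ 𝓝 γm, B ⊆ M.Θ ×ˢ M.𝒴 ∧ ∃ H : Par p m → Par p m,
      (∀ γ ∈ B, ∀ γ', M.IsEPLStep x N γ γ' ↔ γ' = H γ) ∧ MapsTo H B B ∧ LipschitzOnWith κ H B := by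
  have hbc : Metric.ball M.γ₀ r ⊆ Metric.closedBall M.γ₀ r := Metric.ball_subset_closedBall
  have hcont := continuousOn_stepObj hA x N hr hJ
  have hγm' := hbc hγm
  have hfix := mle_isEPLStep_iff hA hmle (mem_interior_𝒴 hr hγm') (hJ _ hγm') hU
  have hstep := (hfix γm).2 rfl
  have hθm : γm.1 ∈ Metric.ball M.γ₀.1 r := by
    rw [Metric.mem_ball, Prod.dist_eq] at hγm
    exact (le_max_left _ _).trans_lt hγm
  -- far from the true parameter the objective stays below its value at the estimate
  have hfar : ∀ᶠ γ in 𝓝 γm, ∀ θ ∈ M.Θ \ Metric.ball M.γ₀.1 r,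
      θ ∈ M.Θ → M.stepObj x N γ θ < M.stepObj x N γ γm.1 := by
    refine (hA.compact_Θ.diff Metric.isOpen_ball).eventually_forall_of_forall_eventually ?_
    intro θ hθ
    have hlt : M.stepObj x N γm θ < M.stepObj x N γm γm.1 := by
      refine lt_of_le_of_ne (hstep.2.2.1 hθ.1) fun heq => hθ.2 ?_
      have hmax : IsMaxOn (M.stepObj x N γm) M.Θ θ := fun θ' hθ' =>
        (hstep.2.2.1 hθ').trans heq.ge
      have : θ = γm.1 := hU.1.unique ⟨hθ.1, hmax⟩ ⟨hstep.2.1, hstep.2.2.1⟩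
      rwa [this]
    have c1 := (hcont (γm, θ) ⟨hγm', hθ.1⟩).tendsto
    have c2 : Tendsto (fun q : Par p m × Vec p => M.stepObj x N q.1 γm.1)
        (𝓝[Metric.closedBall M.γ₀ r ×ˢ M.Θ] (γm, θ)) (𝓝 (M.stepObj x N γm γm.1)) := by
      have hc : ContinuousOn (fun q : Par p m × Vec p => M.stepObj x N q.1 γm.1)
          (Metric.closedBall M.γ₀ r ×ˢ M.Θ) :=
        hcont.comp (f := fun q : Par p m × Vec p => (q.1, γm.1)) (by fun_prop)
          fun q hq => ⟨hq.1, hmle.1.1⟩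
      exact hc (γm, θ) ⟨hγm', hθ.1⟩
    have c3 := eventually_nhdsWithin_iff.1 (c1.eventually_lt c2 hlt)
    have c4 : ∀ᶠ q : Par p m × Vec p in 𝓝 (γm, θ), q.1 ∈ Metric.ball M.γ₀ r :=
      continuousAt_fst.eventually (Metric.isOpen_ball.mem_nhds hγm)
    filter_upwards [c3, c4] with q h3 h4 h5
    exact h3 ⟨hbc h4, h5⟩
  -- hence the maximizer is a root of the score near the true parameter
  have hroot : ∀ γ ∈ Metric.ball M.γ₀ r, (∀ θ ∈ M.Θ \ Metric.ball M.γ₀.1 r,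
      θ ∈ M.Θ → M.stepObj x N γ θ < M.stepObj x N γ γm.1) → ∀ θ ∈ M.Θ,
      IsMaxOn (M.stepObj x N γ) M.Θ θ → (θ, γ) ∈ Metric.closedBall M.z₀ r ∧
        M.stepScore (M.sampleQ x N) (θ, γ) = 0 := by
    intro γ hγ hγf θ hθ hmax
    have hθb : θ ∈ Metric.ball M.γ₀.1 r := by
      by_contra h
      exact absurd (hmax hmle.1.1) (not_le.2 (hγf θ ⟨hθ, h⟩ hθ))
    have hθc := Metric.ball_subset_closedBall hθb
    have hz : (θ, γ) ∈ Metric.closedBall M.z₀ r :=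
      Model.IsRegularBall.prodMk_mem hθc (hbc hγ)
    have hloc := hmax.isLocalMax (mem_interior_iff_mem_nhds.1 (mem_interior_Θ hr hθc))
    exact ⟨hz, hloc.hasFDerivAt_eq_zero (hg.hasFDerivAt _ hz)⟩
  have hex : ∀ γ ∈ Metric.ball M.γ₀ r, ∃ θ ∈ M.Θ, IsMaxOn (M.stepObj x N γ) M.Θ θ := by
    intro γ hγ
    refine hA.compact_Θ.exists_isMaxOn ⟨_, hmle.1.1⟩ ?_
    exact hcont.comp (f := fun θ => (γ, θ)) (by fun_prop) fun θ hθ => ⟨hbc hγ, hθ⟩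
  obtain ⟨ρ, hρ, hρs⟩ := Metric.nhds_basis_closedBall.eventually_iff.1
    (hfar.and (Metric.isOpen_ball.mem_nhds hγm))
  have hch : ∀ γ, ∃ θ, γ ∈ Metric.closedBall γm ρ →
      θ ∈ M.Θ ∧ IsMaxOn (M.stepObj x N γ) M.Θ θ := by
    intro γ
    by_cases h : γ ∈ Metric.closedBall γm ρ
    · obtain ⟨θ, h1, h2⟩ := hex γ (hρs h).2
      exact ⟨θ, fun _ => ⟨h1, h2⟩⟩
    · exact ⟨0, fun h' => absurd h' h⟩
  choose t ht using hch
  have hiff : ∀ γ ∈ Metric.closedBall γm ρ, ∀ γ',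
      M.IsEPLStep x N γ γ' ↔ γ' = M.updatePt (t γ, γ) := by
    intro γ hγ γ'
    obtain ⟨h1, h2⟩ := ht γ hγ
    have hb := (hρs hγ).2
    constructor
    · rintro ⟨_, h3, h4, h5⟩
      obtain ⟨z1, s1⟩ := hroot γ hb (hρs hγ).1 _ h3 h4
      obtain ⟨z2, s2⟩ := hroot γ hb (hρs hγ).1 _ h1 h2
      have h6 : γ'.1 = t γ := by
        have := (hg.solve _ z1 _ z2 s1 s2).1
        simpa [sub_eq_zero] using this
      refine Prod.ext h6 ?_
      rw [h5, h6]
      rfl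
    · rintro rfl
      exact ⟨hJ γ (hbc hb), h1, h2, rfl⟩
  have hlip : LipschitzOnWith κ (fun γ => M.updatePt (t γ, γ)) (Metric.closedBall γm ρ) := by
    refine LipschitzOnWith.of_dist_le_mul fun γ₁ h₁ γ₂ h₂ => ?_
    obtain ⟨z1, s1⟩ := hroot γ₁ (hρs h₁).2 (hρs h₁).1 _ (ht γ₁ h₁).1 (ht γ₁ h₁).2
    obtain ⟨z2, s2⟩ := hroot γ₂ (hρs h₂).2 (hρs h₂).1 _ (ht γ₂ h₂).1 (ht γ₂ h₂).2
    rw [dist_eq_norm, dist_eq_norm]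
    exact (hg.solve _ z1 _ z2 s1 s2).2
  have hself := Metric.mem_closedBall_self (x := γm) hρ.le
  refine ⟨Metric.closedBall γm ρ, Metric.closedBall_mem_nhds _ hρ,
    fun γ hγ => interior_subset (hr (hbc (hρs hγ).2)), fun γ => M.updatePt (t γ, γ), hiff, ?_, hlip⟩
  intro γ hγ
  have h1 : M.updatePt (t γm, γm) = γm := ((hiff γm hself γm).1 hstep).symm
  have h2 := hlip.dist_le_mul γ hγ γm hself
  simp only [h1] at h2
  rw [Metric.mem_closedBall] at hγ ⊢
  have h3 : (κ : ℝ) ≤ 1 := by exact_mod_cast hκ.le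
  calc _ ≤ _ := h2
    _ ≤ 1 * dist γ γm := by gcongr
    _ ≤ ρ := by simpa using hγ

end Sample


/-! ### Laws of large numbers -/

section WPA1

variable {Ω : Type*} [MeasurableSpace Ω] {μ : Measure Ω}

theorem WPA1.mono {A B : ℕ → Ω → Prop} (hA : WPA1 μ A) (h : ∀ᶠ N in atTop, ∀ ω, A N ω → B N ω) :
    WPA1 μ B :=
  tendsto_of_tendsto_of_tendsto_of_le_of_le' tendsto_const_nhds hA
    (Eventually.of_forall fun _ => zero_le)
    (h.mono fun _ hN => measure_mono fun ω hω hAω => hω (hN ω hAω))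

theorem WPA1.mono' {A B : ℕ → Ω → Prop} (hA : WPA1 μ A) (h : ∀ N ω, A N ω → B N ω) : WPA1 μ B :=
  hA.mono (Eventually.of_forall h)

theorem WPA1.and {A B : ℕ → Ω → Prop} (hA : WPA1 μ A) (hB : WPA1 μ B) :
    WPA1 μ fun N ω => A N ω ∧ B N ω := by
  have h := Tendsto.add hA hB
  rw [add_zero] at h
  refine tendsto_of_tendsto_of_tendsto_of_le_of_le tendsto_const_nhds h (fun _ => zero_le)
    fun N => (measure_mono fun ω hω => ?_).trans (measure_union_le _ _)
  by_cases h1 : A N ω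
  · exact Or.inr fun h2 => hω ⟨h1, h2⟩
  · exact Or.inl h1

theorem WPA1.of_forall {A : ℕ → Ω → Prop} (h : ∀ N ω, A N ω) : WPA1 μ A := by
  have : (fun N => μ {ω | ¬ A N ω}) = fun _ => 0 := by
    funext N
    simp [h]
  rw [WPA1, this]
  exact tendsto_const_nhds

theorem WPA1.eventually_le {A : ℕ → Ω → Prop} (h : WPA1 μ A) {ε : ℝ≥0∞} (hε : 0 < ε) :
    ∀ᶠ N in atTop, μ {ω | ¬ A N ω} ≤ ε :=
  (h.eventually (gt_mem_nhds hε)).mono fun _ => le_of_lt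

end WPA1

section Measurability

variable {𝒲 V F : Type*} [MeasurableSpace 𝒲] [NormedAddCommGroup V] [NormedSpace ℝ V]
  [FiniteDimensional ℝ V] [NormedAddCommGroup F] [NormedSpace ℝ F]

theorem stronglyMeasurable_clm_of_apply {L : 𝒲 → V →L[ℝ] F}
    (h : ∀ v, StronglyMeasurable fun x => L x v) : StronglyMeasurable L := by
  set b := Module.finBasis ℝ V
  have e : L = fun x => ∑ i, ContinuousLinearMap.smulRightL ℝ V F
      (LinearMap.toContinuousLinearMap (b.coord i)) (L x (b i)) := by
    funext x
    refine ContinuousLinearMap.ext fun v => ?_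
    conv_lhs => rw [← b.sum_repr v, map_sum]
    simp
  rw [e]
  exact Finset.stronglyMeasurable_fun_sum _ fun i _ =>
    (ContinuousLinearMap.continuous _).comp_stronglyMeasurable (h (b i))

/-- The derivative in a parameter of a family of measurable functions is measurable. -/
theorem stronglyMeasurable_fderiv_of_param {f : 𝒲 → V → F} {y : V}
    (hm : ∀ᶠ y' in 𝓝 y, StronglyMeasurable fun x => f x y')
    (hd : ∀ x, DifferentiableAt ℝ (f x) y) : StronglyMeasurable fun x => fderiv ℝ (f x) y := by
  refine stronglyMeasurable_clm_of_apply fun v => ?_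
  have hlim : Tendsto (fun n : ℕ => (n : ℝ)⁻¹) atTop (𝓝 0) := tendsto_inv_atTop_nhds_zero_nat
  have hy : Tendsto (fun n : ℕ => y + (n : ℝ)⁻¹ • v) atTop (𝓝 y) := by
    simpa using (hlim.smul_const v).const_add y
  obtain ⟨n₀, hn₀⟩ := eventually_atTop.1 (hy.eventually hm)
  refine stronglyMeasurable_of_tendsto atTop
    (f := fun n x => ((n + n₀ + 1 : ℕ) : ℝ) • (f x (y + (((n + n₀ + 1 : ℕ) : ℝ))⁻¹ • v) - f x y))
    (fun n => ((hn₀ (n + n₀ + 1) (by omega)).sub hm.self_of_nhds).const_smul _) ?_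
  rw [tendsto_pi_nhds]
  intro x
  refine (hd x).hasFDerivAt.lim v ?_
  simp only [Real.norm_natCast]
  exact tendsto_natCast_atTop_atTop.comp
    (tendsto_atTop_mono (fun n => show n ≤ _ by omega) tendsto_id)

end Measurability

section LLN

variable {p m : ℕ} {𝒲 Ω : Type*} [MeasurableSpace 𝒲] [MeasurableSpace Ω] {M : Model p m 𝒲}
  {μ : Measure Ω} {w : ℕ → Ω → 𝒲}

theorem γ₀_mem (hA : BasicAssumptions M μ w) : M.γ₀ ∈ M.Θ ×ˢ M.𝒴 := interior_subset hA.interior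

theorem isProbabilityMeasure_trueLaw (hA : BasicAssumptions M μ w) :
    IsProbabilityMeasure M.trueLaw := by
  constructor
  rw [Model.trueLaw, withDensity_apply _ MeasurableSet.univ, Measure.restrict_univ]
  exact hA.lik_lintegral _ ⟨(γ₀_mem hA).1, trivial⟩

theorem integrable_comp_obs (hA : BasicAssumptions M μ w) {E : Type*} [NormedAddCommGroup E]
    {g : 𝒲 → E} (hm : StronglyMeasurable g) (hg : Integrable g M.trueLaw) (i : ℕ) :
    Integrable (fun ω => g (w i ω)) μ := by
  rw [← hA.obs_law i] at hg
  exact (integrable_map_measure hm.aestronglyMeasurable (hA.obs_measurable i).aemeasurable).1 hg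

theorem integral_comp_obs (hA : BasicAssumptions M μ w) {E : Type*} [NormedAddCommGroup E]
    [NormedSpace ℝ E] {g : 𝒲 → E} (hm : StronglyMeasurable g) (i : ℕ) :
    ∫ ω, g (w i ω) ∂μ = ∫ x, g x ∂M.trueLaw := by
  rw [← hA.obs_law i]
  exact (integral_map (hA.obs_measurable i).aemeasurable hm.aestronglyMeasurable).symm

/-- The weak law of large numbers for functions of the observations. -/
theorem wpa1_average [IsProbabilityMeasure μ] (hA : BasicAssumptions M μ w) {E : Type*}
    [NormedAddCommGroup E] [NormedSpace ℝ E] [CompleteSpace E] {g : 𝒲 → E}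
    (hm : StronglyMeasurable g) (hg : Integrable g M.trueLaw) {η : ℝ} (hη : 0 < η) :
    WPA1 μ fun N ω =>
      ‖(N : ℝ)⁻¹ • ∑ i ∈ Finset.range N, g (w i ω) - ∫ x, g x ∂M.trueLaw‖ < η := by
  borelize E
  have hid : ∀ i, IdentDistrib (w i) (w 0) μ μ := fun i =>
    ⟨(hA.obs_measurable i).aemeasurable, (hA.obs_measurable 0).aemeasurable, by
      rw [hA.obs_law, hA.obs_law]⟩
  have hint := integrable_comp_obs hA hm hg
  have h1 := strong_law_ae (μ := μ) (fun i ω => g (w i ω)) (hint 0)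
    (fun i j hij => (hA.obs_indep.indepFun hij).comp hm.measurable hm.measurable)
    (fun i => (hid i).comp hm.measurable)
  rw [integral_comp_obs hA hm 0] at h1
  have h2 := tendstoInMeasure_of_tendsto_ae (fun N => ?_) h1
  · rw [tendstoInMeasure_iff_norm] at h2
    have := h2 η hη
    simpa [WPA1, not_lt] using this
  · exact (Finset.aestronglyMeasurable_fun_sum _
      fun i _ => (hint i).aestronglyMeasurable).const_smul _

/-- Stochastic equicontinuity: for a dominated continuous family, the average oscillation around a
point is small on a small ball, with probability approaching one. -/
theorem exists_wpa1_average_oscillation [IsProbabilityMeasure μ] (hA : BasicAssumptions M μ w)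
    {V E : Type*} [PseudoMetricSpace V] [SecondCountableTopology V] [NormedAddCommGroup E]
    {h : 𝒲 → V → E} {s : Set V} {B : 𝒲 → ℝ} {y : V} (hy : y ∈ s)
    (hm : ∀ y' ∈ s, StronglyMeasurable fun x => h x y') (hc : ∀ x, ContinuousOn (h x) s)
    (hB : Integrable B M.trueLaw) (hhB : ∀ x, ∀ y' ∈ s, ‖h x y'‖ ≤ B x) {η : ℝ} (hη : 0 < η) :
    ∃ ρ > 0, WPA1 μ fun N ω => ∀ y' ∈ s ∩ Metric.closedBall y ρ,
      (N : ℝ)⁻¹ * ∑ i ∈ Finset.range N, ‖h (w i ω) y' - h (w i ω) y‖ ≤ η := by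
  have := isProbabilityMeasure_trueLaw hA
  set T : ℕ → Set V := fun n => s ∩ Metric.closedBall y ((n : ℝ) + 1)⁻¹ with hT
  have hD : ∀ n, ∃ D ⊆ T n, D.Countable ∧ T n ⊆ closure D := fun n =>
    (TopologicalSpace.IsSeparable.of_separableSpace (T n)).exists_countable_dense_subset
  choose D hDT hDc hDd using hD
  -- the oscillation over a countable dense subset, which is measurable
  set osc : ℕ → 𝒲 → ℝ≥0∞ := fun n x => ⨆ y' ∈ D n, ‖h x y' - h x y‖ₑ with hosc
  have hosm : ∀ n, Measurable (osc n) := fun n =>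
    Measurable.biSup _ (hDc n) fun y' hy' =>
      ((hm y' (hDT n hy').1).sub (hm y hy)).enorm
  have hosB : ∀ n x, osc n x ≤ ENNReal.ofReal (2 * B x) := by
    intro n x
    refine iSup₂_le fun y' hy' => ?_
    rw [← ofReal_norm]
    refine ENNReal.ofReal_le_ofReal ?_
    linarith [norm_sub_le (h x y') (h x y), hhB x y' (hDT n hy').1, hhB x y hy]
  have hB2 : ∫⁻ x, ENNReal.ofReal (2 * B x) ∂M.trueLaw ≠ ∞ := (hB.const_mul 2).lintegral_lt_top.ne
  have hos0 : ∀ x, Tendsto (fun n => osc n x) atTop (𝓝 0) := by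
    intro x
    rw [ENNReal.tendsto_nhds_zero]
    intro ε hε
    have h1 : Tendsto (fun y' => ‖h x y' - h x y‖ₑ) (𝓝[s] y) (𝓝 0) := by
      have := (((hc x).sub continuousOn_const).enorm y hy).tendsto
        (f := fun y' => ‖h x y' - h x y‖ₑ)
      simpa using this
    obtain ⟨δ, hδ, hδs⟩ := Metric.nhdsWithin_basis_ball.eventually_iff.1
      (ENNReal.tendsto_nhds_zero.1 h1 ε hε)
    have h2 : Tendsto (fun n : ℕ => ((n : ℝ) + 1)⁻¹) atTop (𝓝 0) :=
      tendsto_inv_atTop_zero.comp (tendsto_atTop_add_const_right _ _ tendsto_natCast_atTop_atTop)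
    filter_upwards [h2.eventually (gt_mem_nhds hδ)] with n hn
    refine iSup₂_le fun y' hy' => hδs ⟨?_, (hDT n hy').1⟩
    exact Metric.mem_ball.2 ((Metric.mem_closedBall.1 (hDT n hy').2).trans_lt hn)
  have hlim := tendsto_lintegral_of_dominated_convergence _ hosm
    (fun n => Eventually.of_forall (hosB n)) hB2 (Eventually.of_forall hos0)
  rw [lintegral_zero] at hlim
  obtain ⟨n, hn⟩ := (hlim.eventually (gt_mem_nhds (ENNReal.ofReal_pos.2 (half_pos hη)))).exists
  refine ⟨((n : ℝ) + 1)⁻¹, by positivity, ?_⟩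
  set g : 𝒲 → ℝ := fun x => (osc n x).toReal with hg
  have hgm : Measurable g := (hosm n).ennreal_toReal
  have hfin : ∀ x, osc n x ≠ ∞ := fun x => ((hosB n x).trans_lt ENNReal.ofReal_lt_top).ne
  have hgi : Integrable g M.trueLaw :=
    integrable_toReal_of_lintegral_ne_top (hosm n).aemeasurable (hn.trans ENNReal.ofReal_lt_top).ne
  have hgint : ∫ x, g x ∂M.trueLaw < η / 2 := by
    rw [integral_toReal (hosm n).aemeasurable (Eventually.of_forall fun x => (hfin x).lt_top)]
    exact (ENNReal.lt_ofReal_iff_toReal_lt (hn.trans ENNReal.ofReal_lt_top).ne).1 hn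
  have hgb : ∀ x, ∀ y' ∈ T n, ‖h x y' - h x y‖ ≤ g x := by
    intro x
    have hcl : ∀ y' ∈ D n, ‖h x y' - h x y‖ ≤ g x := by
      intro y' hy'
      have : ‖h x y' - h x y‖ₑ ≤ osc n x := le_iSup₂ (f := fun y' _ => ‖h x y' - h x y‖ₑ) y' hy'
      rw [← toReal_enorm]
      exact ENNReal.toReal_mono (hfin x) this
    intro y' hy'
    have hcw : ContinuousWithinAt (fun y' => ‖h x y' - h x y‖) (D n) y' :=
      (((hc x).sub continuousOn_const).norm y' hy'.1).mono fun z hz => (hDT n hz).1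
    have := hcw.mem_closure (hDd n hy') (t := Iic (g x)) fun z hz => hcl z hz
    rwa [isClosed_Iic.closure_eq] at this
  refine (wpa1_average hA hgm.stronglyMeasurable hgi (half_pos hη)).mono' ?_
  intro N ω hN y' hy'
  rw [Real.norm_eq_abs, smul_eq_mul] at hN
  have h1 := (abs_lt.1 hN).2
  calc _ ≤ (N : ℝ)⁻¹ * ∑ i ∈ Finset.range N, g (w i ω) := by
        gcongr
        exact hgb _ y' hy'
    _ ≤ η := by linarith

end LLN


/-! ### Derivatives of the sample and population objectives -/

section Derivatives

-- the Hessians live in iterated spaces of continuous linear maps, whose instances nest deeply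
set_option maxSynthPendingDepth 5

variable {p m : ℕ} {𝒲 Ω : Type*} [MeasurableSpace 𝒲] [MeasurableSpace Ω] {M : Model p m 𝒲}
  {μ : Measure Ω} {w : ℕ → Ω → 𝒲}

theorem mem_nhds_domain {γ : Par p m} (hγ : γ ∈ interior (M.Θ ×ˢ M.𝒴)) :
    M.Θ ×ˢ (univ : Set (Vec m)) ∈ 𝓝 γ :=
  mem_of_superset (mem_interior_iff_mem_nhds.1 hγ) (prod_mono_right (subset_univ _))

theorem contDiffAt_logLik (hA : BasicAssumptions M μ w) (x : 𝒲) {γ : Par p m}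
    (hγ : γ ∈ interior (M.Θ ×ˢ M.𝒴)) : ContDiffAt ℝ 2 (M.logLik x) γ :=
  (hA.logLik_contDiff x).contDiffAt (mem_nhds_domain hγ)

theorem hasFDerivAt_logLik (hA : BasicAssumptions M μ w) (x : 𝒲) {γ : Par p m}
    (hγ : γ ∈ interior (M.Θ ×ˢ M.𝒴)) :
    HasFDerivAt (M.logLik x) (fderiv ℝ (M.logLik x) γ) γ :=
  ((contDiffAt_logLik hA x hγ).differentiableAt two_ne_zero).hasFDerivAt

theorem hasFDerivAt_fderiv_logLik (hA : BasicAssumptions M μ w) (x : 𝒲) {γ : Par p m}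
    (hγ : γ ∈ interior (M.Θ ×ˢ M.𝒴)) :
    HasFDerivAt (fderiv ℝ (M.logLik x)) (fderiv ℝ (fderiv ℝ (M.logLik x)) γ) γ :=
  (((contDiffAt_logLik hA x hγ).fderiv_right (m := 1) (by norm_num)).differentiableAt
    one_ne_zero).hasFDerivAt

theorem continuousOn_fderiv_fderiv_logLik (hA : BasicAssumptions M μ w) (x : 𝒲) :
    ContinuousOn (fderiv ℝ (fderiv ℝ (M.logLik x))) (interior (M.Θ ×ˢ M.𝒴)) := fun _ hγ =>
  (((contDiffAt_logLik hA x hγ).fderiv_right (m := 1) (by norm_num)).fderiv_right (m := 0)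
    (by norm_num)).continuousAt.continuousWithinAt

theorem stronglyMeasurable_logLik (hA : BasicAssumptions M μ w) {γ : Par p m} (hγ : γ.1 ∈ M.Θ) :
    StronglyMeasurable fun x => M.logLik x γ :=
  (hA.lik_measurable γ ⟨hγ, trivial⟩).log.stronglyMeasurable

theorem stronglyMeasurable_fderiv_logLik (hA : BasicAssumptions M μ w) {γ : Par p m}
    (hγ : γ ∈ interior (M.Θ ×ˢ M.𝒴)) : StronglyMeasurable fun x => fderiv ℝ (M.logLik x) γ :=
  stronglyMeasurable_fderiv_of_param
    ((show ∀ᶠ γ' in 𝓝 γ, γ' ∈ M.Θ ×ˢ M.𝒴 from mem_interior_iff_mem_nhds.1 hγ).mono fun _ h =>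
      stronglyMeasurable_logLik hA h.1)
    fun x => (hasFDerivAt_logLik hA x hγ).differentiableAt

theorem stronglyMeasurable_fderiv_fderiv_logLik (hA : BasicAssumptions M μ w) {γ : Par p m}
    (hγ : γ ∈ interior (M.Θ ×ˢ M.𝒴)) :
    StronglyMeasurable fun x => fderiv ℝ (fderiv ℝ (M.logLik x)) γ :=
  stronglyMeasurable_fderiv_of_param
    ((show ∀ᶠ γ' in 𝓝 γ, γ' ∈ interior (M.Θ ×ˢ M.𝒴) from
      isOpen_interior.mem_nhds hγ).mono fun _ h =>
      stronglyMeasurable_fderiv_logLik hA h)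
    fun x => (hasFDerivAt_fderiv_logLik hA x hγ).differentiableAt

theorem dominated_logLik (hR : LikelihoodRegularity M) : ∃ B : 𝒲 → ℝ, Integrable B M.trueLaw ∧
    ∀ x, ∀ γ ∈ M.Θ ×ˢ M.𝒴, ‖M.logLik x γ‖ ≤ B x := by
  obtain ⟨B, hB, h⟩ := hR.dominated 0 (by norm_num)
  exact ⟨B, hB, fun x γ hγ => by simpa using h x γ hγ⟩

theorem uniqueDiffOn_domain (hA : BasicAssumptions M μ w) :
    UniqueDiffOn ℝ (M.Θ ×ˢ (univ : Set (Vec m))) :=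
  (uniqueDiffOn_convex hA.convex_Θ (interior_Θ_nonempty hA)).prod uniqueDiffOn_univ

theorem dominated_fderiv_logLik (hA : BasicAssumptions M μ w) (hR : LikelihoodRegularity M) :
    ∃ B : 𝒲 → ℝ, Integrable B M.trueLaw ∧
      ∀ x, ∀ γ ∈ interior (M.Θ ×ˢ M.𝒴), ‖fderiv ℝ (M.logLik x) γ‖ ≤ B x := by
  obtain ⟨B, hB, h⟩ := hR.dominated 1 (by norm_num)
  refine ⟨B, hB, fun x γ hγ => ?_⟩
  have := h x γ (interior_subset hγ)
  rwa [norm_iteratedFDerivWithin_one _ (uniqueDiffOn_domain hA γ ⟨(interior_subset hγ).1, trivial⟩),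
    fderivWithin_of_mem_nhds (mem_nhds_domain hγ)] at this

theorem dominated_fderiv_fderiv_logLik (hA : BasicAssumptions M μ w)
    (hR : LikelihoodRegularity M) : ∃ B : 𝒲 → ℝ, Integrable B M.trueLaw ∧
      ∀ x, ∀ γ ∈ interior (M.Θ ×ˢ M.𝒴), ‖fderiv ℝ (fderiv ℝ (M.logLik x)) γ‖ ≤ B x := by
  obtain ⟨B, hB, h⟩ := hR.dominated 2 le_rfl
  refine ⟨B, hB, fun x γ hγ => ?_⟩
  have h1 := h x γ (interior_subset hγ)
  have hmem : γ ∈ M.Θ ×ˢ (univ : Set (Vec m)) := ⟨(interior_subset hγ).1, trivial⟩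
  rw [← norm_iteratedFDerivWithin_fderivWithin (uniqueDiffOn_domain hA) hmem,
    norm_iteratedFDerivWithin_one _ (uniqueDiffOn_domain hA γ hmem),
    fderivWithin_of_mem_nhds (mem_nhds_domain hγ)] at h1
  have h2 : fderivWithin ℝ (M.logLik x) (M.Θ ×ˢ univ) =ᶠ[𝓝 γ] fderiv ℝ (M.logLik x) := by
    filter_upwards [isOpen_interior.mem_nhds hγ] with γ' hγ'
    exact fderivWithin_of_mem_nhds (mem_nhds_domain hγ')
  rwa [h2.fderiv_eq] at h1

theorem integrable_logLik (hA : BasicAssumptions M μ w) (hR : LikelihoodRegularity M) {γ : Par p m}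
    (hγ : γ ∈ M.Θ ×ˢ M.𝒴) : Integrable (fun x => M.logLik x γ) M.trueLaw := by
  obtain ⟨B, hB, h⟩ := dominated_logLik hR
  exact hB.mono' (stronglyMeasurable_logLik hA hγ.1).aestronglyMeasurable
    (Eventually.of_forall fun x => h x γ hγ)

theorem integrable_fderiv_logLik (hA : BasicAssumptions M μ w) (hR : LikelihoodRegularity M)
    {γ : Par p m} (hγ : γ ∈ interior (M.Θ ×ˢ M.𝒴)) :
    Integrable (fun x => fderiv ℝ (M.logLik x) γ) M.trueLaw := by
  obtain ⟨B, hB, h⟩ := dominated_fderiv_logLik hA hR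
  exact hB.mono' (stronglyMeasurable_fderiv_logLik hA hγ).aestronglyMeasurable
    (Eventually.of_forall fun x => h x γ hγ)

theorem integrable_fderiv_fderiv_logLik (hA : BasicAssumptions M μ w)
    (hR : LikelihoodRegularity M) {γ : Par p m} (hγ : γ ∈ interior (M.Θ ×ˢ M.𝒴)) :
    Integrable (fun x => fderiv ℝ (fderiv ℝ (M.logLik x)) γ) M.trueLaw := by
  obtain ⟨B, hB, h⟩ := dominated_fderiv_fderiv_logLik hA hR
  exact hB.mono' (stronglyMeasurable_fderiv_fderiv_logLik hA hγ).aestronglyMeasurable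
    (Eventually.of_forall fun x => h x γ hγ)

theorem hasFDerivAt_popQ (hA : BasicAssumptions M μ w) (hR : LikelihoodRegularity M)
    {γ : Par p m} (hγ : γ ∈ interior (M.Θ ×ˢ M.𝒴)) :
    HasFDerivAt M.popQ (∫ x, fderiv ℝ (M.logLik x) γ ∂M.trueLaw) γ := by
  obtain ⟨B, hB, h⟩ := dominated_fderiv_logLik hA hR
  have hn := isOpen_interior.mem_nhds hγ
  exact hasFDerivAt_integral_of_dominated_of_fderiv_le (F := fun γ x => M.logLik x γ)
    (F' := fun γ x => fderiv ℝ (M.logLik x) γ) hn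
    ((show ∀ᶠ γ' in 𝓝 γ, γ' ∈ interior (M.Θ ×ˢ M.𝒴) from hn).mono fun _ h =>
      (stronglyMeasurable_logLik hA (interior_subset h).1).aestronglyMeasurable)
    (integrable_logLik hA hR (interior_subset hγ))
    (stronglyMeasurable_fderiv_logLik hA hγ).aestronglyMeasurable
    (Eventually.of_forall h) hB
    (Eventually.of_forall fun x _ hγ' => hasFDerivAt_logLik hA x hγ')

/-- The expected Hessian of the log-likelihood at the true parameter. -/
noncomputable def Model.expHessian (M : Model p m 𝒲) : Par p m →L[ℝ] Par p m →L[ℝ] ℝ :=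
  ∫ x, fderiv ℝ (fderiv ℝ (M.logLik x)) M.γ₀ ∂M.trueLaw

theorem hasFDerivAt_fderiv_popQ (hA : BasicAssumptions M μ w) (hR : LikelihoodRegularity M) :
    HasFDerivAt (fderiv ℝ M.popQ) M.expHessian M.γ₀ := by
  obtain ⟨B, hB, h⟩ := dominated_fderiv_fderiv_logLik hA hR
  have hn := isOpen_interior.mem_nhds hA.interior
  have h1 : fderiv ℝ M.popQ =ᶠ[𝓝 M.γ₀] fun γ => ∫ x, fderiv ℝ (M.logLik x) γ ∂M.trueLaw := by
    filter_upwards [hn] with γ hγ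
    exact (hasFDerivAt_popQ hA hR hγ).fderiv
  refine HasFDerivAt.congr_of_eventuallyEq ?_ h1
  exact hasFDerivAt_integral_of_dominated_of_fderiv_le
    (F := fun γ x => fderiv ℝ (M.logLik x) γ)
    (F' := fun γ x => fderiv ℝ (fderiv ℝ (M.logLik x)) γ) hn
    ((show ∀ᶠ γ' in 𝓝 M.γ₀, γ' ∈ interior (M.Θ ×ˢ M.𝒴) from hn).mono fun _ h =>
      (stronglyMeasurable_fderiv_logLik hA h).aestronglyMeasurable)
    (integrable_fderiv_logLik hA hR hA.interior)
    (stronglyMeasurable_fderiv_fderiv_logLik hA hA.interior).aestronglyMeasurable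
    (Eventually.of_forall h) hB
    (Eventually.of_forall fun x _ hγ' => hasFDerivAt_fderiv_logLik hA x hγ')

/-- The information inequality: the true parameter maximizes the population objective, also among
parameters that violate the constraint, because `log t ≤ t - 1`. -/
theorem popQ_le (hA : BasicAssumptions M μ w) (hR : LikelihoodRegularity M) {γ : Par p m}
    (hγ : γ ∈ M.Θ ×ˢ M.𝒴) : M.popQ γ ≤ M.popQ M.γ₀ := by
  have := isProbabilityMeasure_trueLaw hA
  have h0 := γ₀_mem hA
  have hm0 := hA.lik_measurable M.γ₀ ⟨h0.1, trivial⟩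
  have hm := hA.lik_measurable γ ⟨hγ.1, trivial⟩
  have hpos : ∀ x, 0 < M.lik x γ / M.lik x M.γ₀ := fun x =>
    div_pos (hA.lik_pos x γ ⟨hγ.1, trivial⟩) (hA.lik_pos x _ ⟨h0.1, trivial⟩)
  have hl : ∫⁻ x, ENNReal.ofReal (M.lik x γ / M.lik x M.γ₀) ∂M.trueLaw = 1 := by
    have hrm : Measurable fun x => ENNReal.ofReal (M.lik x γ / M.lik x M.γ₀) :=
      (hm.div hm0).ennreal_ofReal
    rw [Model.trueLaw, lintegral_withDensity_eq_lintegral_mul _ hm0.ennreal_ofReal hrm,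
      ← hA.lik_lintegral γ ⟨hγ.1, trivial⟩]
    refine lintegral_congr fun x => ?_
    have hp := hA.lik_pos x _ (⟨h0.1, trivial⟩ : M.γ₀ ∈ M.Θ ×ˢ univ)
    rw [Pi.mul_apply, ← ENNReal.ofReal_mul hp.le, mul_div_cancel₀ _ hp.ne']
  have hri : Integrable (fun x => M.lik x γ / M.lik x M.γ₀) M.trueLaw := by
    refine ⟨(hm.div hm0).aestronglyMeasurable, ?_⟩
    rw [hasFiniteIntegral_iff_ofReal (Eventually.of_forall fun x => (hpos x).le), hl]
    exact ENNReal.one_lt_top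
  have hr1 : ∫ x, M.lik x γ / M.lik x M.γ₀ ∂M.trueLaw = 1 := by
    rw [integral_eq_lintegral_of_nonneg_ae (Eventually.of_forall fun x => (hpos x).le)
      hri.aestronglyMeasurable, hl, ENNReal.toReal_one]
  have hle : ∫ x, (M.logLik x γ - M.logLik x M.γ₀) ∂M.trueLaw
      ≤ ∫ x, (M.lik x γ / M.lik x M.γ₀ - 1) ∂M.trueLaw := by
    refine integral_mono ((integrable_logLik hA hR hγ).sub (integrable_logLik hA hR h0))
      (hri.sub (integrable_const _)) fun x => ?_
    change Real.log _ - Real.log _ ≤ _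
    rw [← Real.log_div (hA.lik_pos x γ ⟨hγ.1, trivial⟩).ne'
      (hA.lik_pos x _ ⟨h0.1, trivial⟩).ne']
    exact Real.log_le_sub_one_of_pos (hpos x)
  rw [integral_sub (integrable_logLik hA hR hγ) (integrable_logLik hA hR h0),
    integral_sub hri (integrable_const _), hr1] at hle
  simp only [integral_const, probReal_univ, one_smul, sub_self] at hle
  exact sub_nonpos.1 hle

theorem fderiv_popQ_eq_zero (hA : BasicAssumptions M μ w) (hR : LikelihoodRegularity M) :
    fderiv ℝ M.popQ M.γ₀ = 0 := by
  refine IsLocalMax.fderiv_eq_zero ?_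
  filter_upwards [mem_interior_iff_mem_nhds.1 hA.interior] with γ hγ
  exact popQ_le hA hR hγ

/-- The score has expectation zero at the true parameter. -/
theorem integral_score_eq_zero (hA : BasicAssumptions M μ w) (hR : LikelihoodRegularity M) :
    ∫ x, fderiv ℝ (M.logLik x) M.γ₀ ∂M.trueLaw = 0 := by
  rw [← (hasFDerivAt_popQ hA hR hA.interior).fderiv, fderiv_popQ_eq_zero hA hR]

theorem hasFDerivAt_sampleQ (hA : BasicAssumptions M μ w) (x : ℕ → 𝒲) (N : ℕ) {γ : Par p m}
    (hγ : γ ∈ interior (M.Θ ×ˢ M.𝒴)) : HasFDerivAt (M.sampleQ x N)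
      ((N : ℝ)⁻¹ • ∑ i ∈ Finset.range N, fderiv ℝ (M.logLik (x i)) γ) γ :=
  (HasFDerivAt.fun_sum fun i _ => hasFDerivAt_logLik hA (x i) hγ).const_mul _

theorem fderiv_sampleQ (hA : BasicAssumptions M μ w) (x : ℕ → 𝒲) (N : ℕ) {γ : Par p m}
    (hγ : γ ∈ interior (M.Θ ×ˢ M.𝒴)) : fderiv ℝ (M.sampleQ x N) γ
      = (N : ℝ)⁻¹ • ∑ i ∈ Finset.range N, fderiv ℝ (M.logLik (x i)) γ :=
  (hasFDerivAt_sampleQ hA x N hγ).fderiv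

theorem hasFDerivAt_fderiv_sampleQ (hA : BasicAssumptions M μ w) (x : ℕ → 𝒲) (N : ℕ) {γ : Par p m}
    (hγ : γ ∈ interior (M.Θ ×ˢ M.𝒴)) : HasFDerivAt (fderiv ℝ (M.sampleQ x N))
      ((N : ℝ)⁻¹ • ∑ i ∈ Finset.range N, fderiv ℝ (fderiv ℝ (M.logLik (x i))) γ) γ := by
  refine HasFDerivAt.congr_of_eventuallyEq
    ((HasFDerivAt.fun_sum fun i _ => hasFDerivAt_fderiv_logLik hA (x i) hγ).const_smul (N : ℝ)⁻¹) ?_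
  filter_upwards [isOpen_interior.mem_nhds hγ] with γ' hγ'
  exact fderiv_sampleQ hA x N hγ'

/-- At the true parameter the curvature term that involves second derivatives of the constraint
vanishes with the expected score, so the information matrix is the expected Hessian along the
tangent of the constraint set. -/
theorem information_eq (hA : BasicAssumptions M μ w) (hR : LikelihoodRegularity M) (u : Vec p) :
    M.information u = -(M.expHessian (M.updateDeriv M.z₀ u)).comp (M.updateDeriv M.z₀) := by
  obtain ⟨r, C, hB⟩ := exists_isRegularBall hA
  have hc : Tendsto (fun θ : Vec p => (θ, M.γ₀)) (𝓝 M.γ₀.1) (𝓝 M.z₀) :=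
    Continuous.tendsto (by fun_prop) _
  have hz₀ : M.updatePt M.z₀ = M.γ₀ := updatePt_of_constraint hA.constraint
  have hball : ∀ᶠ θ in 𝓝 M.γ₀.1, (θ, M.γ₀) ∈ Metric.closedBall M.z₀ r :=
    hc.eventually (Metric.closedBall_mem_nhds _ hB.pos)
  have hz₀d := hB.hasFDerivAt_left hB.self_mem
  have hint : ∀ᶠ θ in 𝓝 M.γ₀.1, M.updatePt (θ, M.γ₀) ∈ interior (M.Θ ×ˢ M.𝒴) := by
    refine hz₀d.continuousAt.eventually (isOpen_interior.mem_nhds ?_)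
    change M.updatePt M.z₀ ∈ _
    rw [hz₀]
    exact hA.interior
  have h1 : fderiv ℝ M.popStepObj =ᶠ[𝓝 M.γ₀.1] fun θ =>
      (fderiv ℝ M.popQ (M.updatePt (θ, M.γ₀))).comp (M.updateDeriv (θ, M.γ₀)) := by
    filter_upwards [hball, hint] with θ hθ hθ'
    exact (HasFDerivAt.comp (g := M.popQ) (f := fun θ => M.updatePt (θ, M.γ₀)) θ
      (hasFDerivAt_popQ hA hR hθ').differentiableAt.hasFDerivAt (hB.hasFDerivAt_left hθ)).fderiv
  have h2 : HasFDerivAt (fun θ => fderiv ℝ M.popQ (M.updatePt (θ, M.γ₀)))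
      (M.expHessian.comp (M.updateDeriv M.z₀)) M.γ₀.1 := by
    refine HasFDerivAt.comp (g := fderiv ℝ M.popQ) (f := fun θ => M.updatePt (θ, M.γ₀)) M.γ₀.1 ?_
      hz₀d
    change HasFDerivAt _ _ (M.updatePt M.z₀)
    rw [hz₀]
    exact hasFDerivAt_fderiv_popQ hA hR
  have h3 : DifferentiableAt ℝ (fun θ => M.updateDeriv (θ, M.γ₀)) M.γ₀.1 := by
    have h4 : DifferentiableAt ℝ (fderiv ℝ M.updatePt) M.z₀ :=
      ((contDiffAt_updatePt hA (z := M.z₀) hA.interior hA.interior hA.jacY_invertible).fderiv_right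
        (m := 1) (by norm_num)).differentiableAt one_ne_zero
    have h5 : DifferentiableAt ℝ (fun θ : Vec p => fderiv ℝ M.updatePt (θ, M.γ₀)) M.γ₀.1 :=
      DifferentiableAt.comp (g := fderiv ℝ M.updatePt) M.γ₀.1 h4 (by fun_prop)
    exact h5.clm_comp (differentiableAt_const _)
  have h6 := (h2.clm_comp h3.hasFDerivAt).congr_of_eventuallyEq h1
  rw [Model.information, h6.fderiv]
  have h7 : fderiv ℝ M.popQ (M.updatePt (M.γ₀.1, M.γ₀)) = 0 := by
    change fderiv ℝ M.popQ (M.updatePt M.z₀) = 0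
    rw [hz₀, fderiv_popQ_eq_zero hA hR]
  ext v
  simp [h7, Model.z₀]

/-- The curvature of the iteration, as an invertible map. -/
theorem exists_curvature_equiv (hA : BasicAssumptions M μ w) (hR : LikelihoodRegularity M) :
    ∃ S : Vec p ≃L[ℝ] (Vec p →L[ℝ] ℝ),
      ∀ u, S u = (M.expHessian (M.updateDeriv M.z₀ u)).comp (M.updateDeriv M.z₀) := by
  have hinj : Function.Injective ((-M.information : Vec p →L[ℝ] Vec p →L[ℝ] ℝ) :
      Vec p →ₗ[ℝ] Vec p →L[ℝ] ℝ) := by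
    rw [injective_iff_map_eq_zero]
    intro u hu
    refine hR.information_nonsingular u ?_
    simpa using hu
  have hfin : Module.finrank ℝ (Vec p) = Module.finrank ℝ (Vec p →L[ℝ] ℝ) := by
    rw [← LinearEquiv.finrank_eq (LinearMap.toContinuousLinearMap : (Vec p →ₗ[ℝ] ℝ) ≃ₗ[ℝ] _)]
    exact (Subspace.dual_finrank_eq (K := ℝ) (V := Vec p)).symm
  refine ⟨(LinearMap.linearEquivOfInjective _ hinj hfin).toContinuousLinearEquiv, fun u => ?_⟩
  change (-M.information) u = _
  rw [neg_apply, information_eq hA hR, neg_neg]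

end Derivatives


/-! ### Asymptotics of the sample objective and consistency of the estimate -/

section Asymptotics

-- needed for the Hessians, as above
set_option maxSynthPendingDepth 5

variable {p m : ℕ} {𝒲 Ω : Type*} [MeasurableSpace 𝒲] [MeasurableSpace Ω] {M : Model p m 𝒲}
  {μ : Measure Ω} {w : ℕ → Ω → 𝒲}

/-- With probability approaching one, the sample Hessian is uniformly close to the expected Hessian
near the true parameter. -/
theorem exists_wpa1_hasNearlyLinearGradient [IsProbabilityMeasure μ] (hA : BasicAssumptions M μ w)
    (hR : LikelihoodRegularity M) {η : ℝ} (hη : 0 < η) : ∃ ρ > 0, WPA1 μ fun N ω =>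
      M.HasNearlyLinearGradient (M.sampleQ (fun i => w i ω) N) M.expHessian η ρ := by
  obtain ⟨B, hB, hd⟩ := dominated_fderiv_fderiv_logLik hA hR
  obtain ⟨ρ₁, hρ₁, hosc⟩ := exists_wpa1_average_oscillation hA
    (h := fun x γ => fderiv ℝ (fderiv ℝ (M.logLik x)) γ) hA.interior
    (fun γ hγ => stronglyMeasurable_fderiv_fderiv_logLik hA hγ)
    (continuousOn_fderiv_fderiv_logLik hA) hB hd (half_pos hη)
  obtain ⟨ρ₂, hρ₂, hsub⟩ := Metric.nhds_basis_closedBall.mem_iff.1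
    (isOpen_interior.mem_nhds hA.interior)
  refine ⟨min ρ₁ ρ₂, lt_min hρ₁ hρ₂, ?_⟩
  have hlln := wpa1_average hA (stronglyMeasurable_fderiv_fderiv_logLik hA hA.interior)
    (integrable_fderiv_fderiv_logLik hA hR hA.interior) (half_pos hη)
  refine (hosc.and hlln).mono' ?_
  rintro N ω ⟨h1, h2⟩ a₁ ha₁ a₂ ha₂
  have hs1 := Metric.closedBall_subset_closedBall (x := M.γ₀) (min_le_left ρ₁ ρ₂)
  have hs2 := (Metric.closedBall_subset_closedBall (x := M.γ₀) (min_le_right ρ₁ ρ₂)).trans hsub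
  refine Convex.norm_image_sub_le_of_norm_hasFDerivWithin_le'
    (fun γ hγ => (hasFDerivAt_fderiv_sampleQ hA (fun i => w i ω) N (hs2 hγ)).hasFDerivWithinAt)
    (fun γ hγ => ?_) (convex_closedBall _ _) ha₂ ha₁
  have h3 := h1 γ ⟨hs2 hγ, hs1 hγ⟩
  have e : (N : ℝ)⁻¹ • ∑ i ∈ Finset.range N, fderiv ℝ (fderiv ℝ (M.logLik (w i ω))) γ
      - M.expHessian
      = (N : ℝ)⁻¹ • ∑ i ∈ Finset.range N, (fderiv ℝ (fderiv ℝ (M.logLik (w i ω))) γ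
          - fderiv ℝ (fderiv ℝ (M.logLik (w i ω))) M.γ₀)
        + ((N : ℝ)⁻¹ • ∑ i ∈ Finset.range N, fderiv ℝ (fderiv ℝ (M.logLik (w i ω))) M.γ₀
          - M.expHessian) := by
    rw [Finset.sum_sub_distrib, smul_sub]
    abel
  rw [e]
  have h4 : ‖(N : ℝ)⁻¹ • ∑ i ∈ Finset.range N, (fderiv ℝ (fderiv ℝ (M.logLik (w i ω))) γ
      - fderiv ℝ (fderiv ℝ (M.logLik (w i ω))) M.γ₀)‖ ≤ η / 2 := by
    rw [norm_smul, Real.norm_of_nonneg (by positivity)]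
    refine le_trans ?_ h3
    gcongr
    exact norm_sum_le _ _
  have h5 : ‖(N : ℝ)⁻¹ • ∑ i ∈ Finset.range N, fderiv ℝ (fderiv ℝ (M.logLik (w i ω))) M.γ₀
      - M.expHessian‖ < η / 2 := h2
  linarith [norm_add_le ((N : ℝ)⁻¹ • ∑ i ∈ Finset.range N,
    (fderiv ℝ (fderiv ℝ (M.logLik (w i ω))) γ - fderiv ℝ (fderiv ℝ (M.logLik (w i ω))) M.γ₀))
    ((N : ℝ)⁻¹ • ∑ i ∈ Finset.range N, fderiv ℝ (fderiv ℝ (M.logLik (w i ω))) M.γ₀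
      - M.expHessian)]

/-- Averages of centred square-integrable functions are `O_p(N^{-1/2})`, by Chebyshev's
inequality. -/
theorem isBigOp_average [IsProbabilityMeasure μ] (hA : BasicAssumptions M μ w) {g : 𝒲 → ℝ}
    (hm : StronglyMeasurable g) (hg : MemLp g 2 M.trueLaw) (h0 : ∫ x, g x ∂M.trueLaw = 0) :
    IsBigOp μ (fun N ω => (N : ℝ)⁻¹ * ∑ i ∈ Finset.range N, g (w i ω))
      fun N _ => (N : ℝ) ^ (-(1 / 2) : ℝ) := by
  intro ε hε
  set X : ℕ → Ω → ℝ := fun i ω => g (w i ω) with hX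
  have hXm : ∀ i, Measurable (X i) := fun i => hm.measurable.comp (hA.obs_measurable i)
  have hLp : ∀ i, MemLp (X i) 2 μ := fun i => by
    rw [← hA.obs_law i] at hg
    exact (memLp_map_measure_iff hm.aestronglyMeasurable (hA.obs_measurable i).aemeasurable).1 hg
  have hmean : ∀ i, ∫ ω, X i ω ∂μ = 0 := fun i => by rw [hX, integral_comp_obs hA hm i, h0]
  set σ : ℝ := ∫ x, g x ^ 2 ∂M.trueLaw with hσ
  have hvar : ∀ i, Var[X i; μ] = σ := by
    intro i
    rw [variance_of_integral_eq_zero (hXm i).aemeasurable (hmean i)]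
    exact integral_comp_obs hA (hm.pow 2) i
  have hσ0 : 0 ≤ σ := integral_nonneg fun x => sq_nonneg _
  have hsum : ∀ N : ℕ, Var[∑ i ∈ Finset.range N, X i; μ] = N * σ := by
    intro N
    rw [IndepFun.variance_sum (fun i _ => hLp i) fun i _ j _ hij =>
      (hA.obs_indep.indepFun hij).comp hm.measurable hm.measurable]
    simp [hvar]
  refine ⟨Real.sqrt (σ / ε) + 1, eventually_atTop.2 ⟨1, fun N hN => ?_⟩⟩
  have hN0 : (0 : ℝ) < N := by exact_mod_cast hN
  set C := Real.sqrt (σ / ε) + 1 with hC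
  have hC0 : 0 < C := by positivity
  have hC2 : σ / ε ≤ C ^ 2 := by
    have h1 := Real.sq_sqrt (div_nonneg hσ0 hε.le)
    have h2 := Real.sqrt_nonneg (σ / ε)
    nlinarith
  have hsq : ((N : ℝ) ^ (-(1 / 2) : ℝ)) ^ 2 = (N : ℝ)⁻¹ := by
    rw [← Real.rpow_natCast, ← Real.rpow_mul hN0.le]
    norm_num
    exact Real.rpow_neg_one _
  have hr0 : 0 < (N : ℝ) ^ (-(1 / 2) : ℝ) := by positivity
  have hch := meas_ge_le_variance_div_sq (memLp_finsetSum' (Finset.range N) fun i _ => hLp i)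
    (c := C * (N : ℝ) ^ (-(1 / 2) : ℝ) * N) (by positivity)
  have hint : ∫ ω, (∑ i ∈ Finset.range N, X i) ω ∂μ = 0 := by
    simp only [Finset.sum_apply]
    rw [integral_finsetSum _ fun i _ => (hLp i).integrable one_le_two]
    simp [hmean]
  rw [hint, hsum] at hch
  refine (measure_mono fun ω hω => ?_).trans (hch.trans (ENNReal.ofReal_le_ofReal ?_))
  · simp only [mem_ofPred_eq, Real.norm_eq_abs, abs_mul, abs_inv, Nat.abs_cast] at hω
    rw [← div_eq_inv_mul, lt_div_iff₀ hN0] at hω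
    simpa [hX] using hω.le
  · rw [mul_pow, mul_pow, hsq, div_le_iff₀ (by positivity)]
    have h1 : σ ≤ C ^ 2 * ε := (div_le_iff₀ hε).1 hC2
    have e : ε * (C ^ 2 * (N : ℝ)⁻¹ * (N : ℝ) ^ 2) = N * (C ^ 2 * ε) := by
      field_simp
    rw [e]
    gcongr

/-- A functional is determined by its values on a basis, with control of the norm. -/
theorem exists_norm_le_sum_basis (V : Type*) [NormedAddCommGroup V] [NormedSpace ℝ V]
    [FiniteDimensional ℝ V] : ∃ (n : ℕ) (b : Fin n → V) (K : Fin n → ℝ), (∀ i, 0 ≤ K i) ∧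
      ∀ L : V →L[ℝ] ℝ, ‖L‖ ≤ ∑ i, K i * ‖L (b i)‖ := by
  set b := Module.finBasis ℝ V
  refine ⟨_, b, fun i => ‖LinearMap.toContinuousLinearMap (b.coord i)‖, fun i => norm_nonneg _, ?_⟩
  intro L
  refine L.opNorm_le_bound (by positivity) fun v => ?_
  conv_lhs => rw [← b.sum_repr v, map_sum]
  refine (norm_sum_le _ _).trans ?_
  rw [Finset.sum_mul]
  refine Finset.sum_le_sum fun i _ => ?_
  rw [map_smul, smul_eq_mul, norm_mul]
  have := (LinearMap.toContinuousLinearMap (b.coord i)).le_opNorm v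
  rw [LinearMap.coe_toContinuousLinearMap', Module.Basis.coord_apply] at this
  calc _ ≤ _ := mul_le_mul_of_nonneg_right this (norm_nonneg _)
    _ = _ := by ring

/-- The sample score at the true parameter is `O_p(N^{-1/2})`. -/
theorem isBigOp_score [IsProbabilityMeasure μ] (hA : BasicAssumptions M μ w)
    (hR : LikelihoodRegularity M) :
    IsBigOp μ (fun N ω => fderiv ℝ (M.sampleQ (fun i => w i ω) N) M.γ₀)
      fun N _ => (N : ℝ) ^ (-(1 / 2) : ℝ) := by
  obtain ⟨n, b, K, hK, hb⟩ := exists_norm_le_sum_basis (Par p m)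
  have hsm := stronglyMeasurable_fderiv_logLik hA hA.interior
  have hsi := integrable_fderiv_logLik hA hR hA.interior
  have hcomp : ∀ i, IsBigOp μ (fun N ω => (N : ℝ)⁻¹ * ∑ j ∈ Finset.range N,
      fderiv ℝ (M.logLik (w j ω)) M.γ₀ (b i)) fun N _ => (N : ℝ) ^ (-(1 / 2) : ℝ) := by
    intro i
    have hm : StronglyMeasurable fun x => fderiv ℝ (M.logLik x) M.γ₀ (b i) :=
      (ContinuousLinearMap.apply ℝ ℝ (b i)).continuous.comp_stronglyMeasurable hsm
    refine isBigOp_average (g := fun x => fderiv ℝ (M.logLik x) M.γ₀ (b i)) hA hm ?_ ?_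
    · rw [memLp_two_iff_integrable_sq hm.aestronglyMeasurable]
      refine (hR.score_sq.mul_const (‖b i‖ ^ 2)).mono' (hm.pow 2).aestronglyMeasurable
        (Eventually.of_forall fun x => ?_)
      rw [norm_pow, ← mul_pow]
      gcongr
      exact ContinuousLinearMap.le_opNorm _ _
    · rw [← ContinuousLinearMap.integral_apply hsi, integral_score_eq_zero hA hR]
      simp
  intro ε hε
  choose C hC using fun i => hcomp i (ε / (n + 1)) (by positivity)
  refine ⟨∑ i, K i * C i, ?_⟩
  filter_upwards [eventually_all.2 hC] with N hN
  have hsub : {ω | (∑ i, K i * C i) * (N : ℝ) ^ (-(1 / 2) : ℝ)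
      < ‖fderiv ℝ (M.sampleQ (fun i => w i ω) N) M.γ₀‖}
      ⊆ ⋃ i ∈ (Finset.univ : Finset (Fin n)), {ω | C i * (N : ℝ) ^ (-(1 / 2) : ℝ)
        < ‖(N : ℝ)⁻¹ * ∑ j ∈ Finset.range N, fderiv ℝ (M.logLik (w j ω)) M.γ₀ (b i)‖} := by
    intro ω hω
    by_contra hnot
    simp only [mem_iUnion, mem_ofPred_eq, not_exists, not_lt, Finset.mem_univ, true_and,
      exists_prop] at hnot hω
    refine absurd hω (not_lt.2 ((hb _).trans ?_))
    rw [Finset.sum_mul]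
    refine Finset.sum_le_sum fun i _ => ?_
    rw [mul_assoc]
    refine mul_le_mul_of_nonneg_left ?_ (hK i)
    rw [fderiv_sampleQ hA _ _ hA.interior]
    simpa [sum_apply] using hnot i
  calc _ ≤ _ := measure_mono hsub
    _ ≤ _ := measure_biUnion_finset_le _ _
    _ ≤ ∑ _i : Fin n, ENNReal.ofReal (ε / (n + 1)) := Finset.sum_le_sum fun i _ => hN i
    _ = ENNReal.ofReal (n * (ε / (n + 1))) := by
        rw [Finset.sum_const, Finset.card_univ, Fintype.card_fin, nsmul_eq_mul,
          ENNReal.ofReal_mul (by positivity), ENNReal.ofReal_natCast]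
    _ ≤ ENNReal.ofReal ε := by
        refine ENNReal.ofReal_le_ofReal ?_
        rw [← mul_div_assoc, div_le_iff₀ (by positivity)]
        nlinarith

theorem wpa1_score_le [IsProbabilityMeasure μ] (hA : BasicAssumptions M μ w)
    (hR : LikelihoodRegularity M) {τ : ℝ} (hτ : 0 < τ) :
    WPA1 μ fun N ω => ‖fderiv ℝ (M.sampleQ (fun i => w i ω) N) M.γ₀‖ ≤ τ := by
  have h := wpa1_average hA (stronglyMeasurable_fderiv_logLik hA hA.interior)
    (integrable_fderiv_logLik hA hR hA.interior) hτ
  rw [integral_score_eq_zero hA hR] at h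
  refine h.mono' fun N ω hN => ?_
  rw [sub_zero] at hN
  rw [fderiv_sampleQ hA _ _ hA.interior]
  exact hN.le

/-- The uniform law of large numbers for the objective. -/
theorem wpa1_uniform [IsProbabilityMeasure μ] (hA : BasicAssumptions M μ w)
    (hR : LikelihoodRegularity M) {η : ℝ} (hη : 0 < η) : WPA1 μ fun N ω =>
      ∀ γ ∈ M.Θ ×ˢ M.𝒴, |M.sampleQ (fun i => w i ω) N γ - M.popQ γ| ≤ η := by
  obtain ⟨B, hB, hd⟩ := dominated_logLik hR
  suffices h : WPA1 μ fun N ω => ∀ γ ∈ (M.Θ ×ˢ M.𝒴) ∩ (M.Θ ×ˢ M.𝒴),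
      |M.sampleQ (fun i => w i ω) N γ - M.popQ γ| ≤ η by simpa using h
  refine (hA.compact_Θ.prod hA.compact_𝒴).induction_on (p := fun t => WPA1 μ fun N ω =>
    ∀ γ ∈ t ∩ (M.Θ ×ˢ M.𝒴), |M.sampleQ (fun i => w i ω) N γ - M.popQ γ| ≤ η) ?_ ?_ ?_ ?_
  · exact WPA1.of_forall fun N ω γ hγ => absurd hγ.1 (notMem_empty γ)
  · exact fun s t hst h => h.mono' fun N ω hN γ hγ => hN γ ⟨hst hγ.1, hγ.2⟩
  · intro s t hs ht
    refine (hs.and ht).mono' fun N ω hN γ hγ => ?_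
    rcases hγ.1 with h | h
    · exact hN.1 γ ⟨h, hγ.2⟩
    · exact hN.2 γ ⟨h, hγ.2⟩
  · intro γ₁ hγ₁
    have hη3 : 0 < η / 3 := by positivity
    obtain ⟨ρ, hρ, hosc⟩ := exists_wpa1_average_oscillation hA (h := fun x γ => M.logLik x γ) hγ₁
      (fun γ hγ => stronglyMeasurable_logLik hA hγ.1)
      (fun x => (hA.logLik_contDiff x).continuousOn.mono (prod_mono_right (subset_univ _)))
      hB hd hη3
    have hlln := wpa1_average hA (stronglyMeasurable_logLik hA hγ₁.1)
      (integrable_logLik hA hR hγ₁) hη3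
    have hpop : ∀ᶠ γ in 𝓝[M.Θ ×ˢ M.𝒴] γ₁, |M.popQ γ - M.popQ γ₁| < η / 3 := by
      have := (hA.popQ_contDiff.continuousOn γ₁ hγ₁).tendsto
      exact this.eventually (Metric.ball_mem_nhds _ hη3)
    refine ⟨_, inter_mem hpop (mem_nhdsWithin_of_mem_nhds (Metric.closedBall_mem_nhds γ₁ hρ)), ?_⟩
    refine (hosc.and hlln).mono' ?_
    rintro N ω ⟨h1, h2⟩ γ ⟨⟨h3, h4⟩, h5⟩
    have h6 := h1 γ ⟨h5, h4⟩
    change ‖M.sampleQ (fun i => w i ω) N γ₁ - M.popQ γ₁‖ < _ at h2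
    have h7 : |M.sampleQ (fun i => w i ω) N γ - M.sampleQ (fun i => w i ω) N γ₁| ≤ η / 3 := by
      rw [Model.sampleQ, Model.sampleQ, ← mul_sub, ← Finset.sum_sub_distrib, abs_mul,
        abs_of_nonneg (by positivity : (0 : ℝ) ≤ (N : ℝ)⁻¹)]
      refine le_trans ?_ h6
      gcongr
      exact Finset.abs_sum_le_sum_abs _ _
    have h8 : |M.popQ γ - M.popQ γ₁| < η / 3 := h3
    rw [Real.norm_eq_abs] at h2
    rw [abs_le] at h7 ⊢
    rw [abs_lt] at h2 h8
    constructor <;> linarith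

/-- The maximum likelihood estimate is consistent. -/
theorem wpa1_mle_mem_ball [IsProbabilityMeasure μ] (hA : BasicAssumptions M μ w)
    (hR : LikelihoodRegularity M) {mle : ℕ → Ω → Par p m}
    (hmle : ∀ N ω, M.IsMLE (fun i => w i ω) N (mle N ω)) {ε : ℝ} (hε : 0 < ε) :
    WPA1 μ fun N ω => mle N ω ∈ Metric.ball M.γ₀ ε := by
  set K : Set (Par p m) := ((M.Θ ×ˢ M.𝒴) ∩ M.G ⁻¹' {0}) \ Metric.ball M.γ₀ ε with hK
  have hSc := hA.compact_Θ.prod hA.compact_𝒴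
  have hKc : IsCompact K := by
    refine IsCompact.diff ?_ Metric.isOpen_ball
    exact hSc.of_isClosed_subset
      (hA.G_contDiff.continuousOn.preimage_isClosed_of_isClosed hSc.isClosed isClosed_singleton)
      inter_subset_left
  have hgap : ∃ η > 0, ∀ γ ∈ K, M.popQ γ + 2 * η < M.popQ M.γ₀ := by
    rcases K.eq_empty_or_nonempty with h | h
    · exact ⟨1, one_pos, by simp [h]⟩
    · obtain ⟨γ₁, h1, h2⟩ := hKc.exists_isMaxOn h
        (hA.popQ_contDiff.continuousOn.mono fun γ hγ => hγ.1.1)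
      have h3 := hA.identification γ₁ h1.1.1 h1.1.2 fun he => h1.2 (by simp [he, hε])
      refine ⟨(M.popQ M.γ₀ - M.popQ γ₁) / 3, by linarith, fun γ hγ => ?_⟩
      have : M.popQ γ ≤ M.popQ γ₁ := h2 hγ
      linarith
  -- twice the uniform error: it enters at the estimate and at the true parameter
  obtain ⟨η, hη, hgap⟩ := hgap
  refine (wpa1_uniform hA hR hη).mono' fun N ω hN => ?_
  by_contra hnot
  obtain ⟨h1, h2, h3⟩ := hmle N ω
  have h4 := hgap _ ⟨⟨h1, h2⟩, hnot⟩
  have h5 := h3 _ (γ₀_mem hA) hA.constraint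
  have h6 := (abs_le.1 (hN _ h1)).2
  have h7 := (abs_le.1 (hN _ (γ₀_mem hA))).1
  linarith

end Asymptotics


/-! ### The iteration in large samples -/

section LargeSamples

variable {p m : ℕ} {𝒲 Ω : Type*} [MeasurableSpace 𝒲] [MeasurableSpace Ω] {M : Model p m 𝒲}
  {μ : Measure Ω} {w : ℕ → Ω → 𝒲}

/-- With probability approaching one, the sample objective is good on a fixed ball around the true
parameter. -/
theorem exists_wpa1_isGoodObjective [IsProbabilityMeasure μ] (hA : BasicAssumptions M μ w)
    (hR : LikelihoodRegularity M) {κ : ℝ} (hκ : 0 < κ) (hκ1 : κ ≤ 1 / 2) :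
    ∃ r > 0, ∃ C > 0, Metric.closedBall M.γ₀ r ⊆ interior (M.Θ ×ˢ M.𝒴) ∧
      (∀ γ ∈ Metric.closedBall M.γ₀ r, (M.jacY γ).IsInvertible) ∧
      WPA1 μ fun N ω => M.IsGoodObjective (M.sampleQ (fun i => w i ω) N) κ C r := by
  obtain ⟨S, hS⟩ := exists_curvature_equiv hA hR
  obtain ⟨η, hη, h⟩ := exists_isGoodObjective hA M.expHessian S hS hκ hκ1
  obtain ⟨ρ, hρ, hlin⟩ := exists_wpa1_hasNearlyLinearGradient hA hR hη
  obtain ⟨r, hr, C, hC, τ, hτ, h1, h2, h3⟩ := h ρ hρ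
  refine ⟨r, hr, C, hC, h1, h2, (hlin.and (wpa1_score_le hA hR hτ)).mono' fun N ω hN => ?_⟩
  exact h3 _ ((contDiffOn_sampleQ hA _ N).differentiableOn two_ne_zero) hN.1 hN.2

/-- One step of the iteration, from a consistent estimate. The bound is stated with the
sample score in place of `N^{-1/2}`, so that it holds with one constant for all sample sizes. -/
theorem exists_step_bound [IsProbabilityMeasure μ] (hA : BasicAssumptions M μ w)
    (hR : LikelihoodRegularity M) {mle : ℕ → Ω → Par p m}
    (hmle : ∀ N ω, M.IsMLE (fun i => w i ω) N (mle N ω)) :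
    ∃ C > 0, ∀ γ γ' : ℕ → Ω → Par p m,
      (∀ ε > 0, WPA1 μ fun N ω => γ N ω ∈ Metric.ball M.γ₀ ε) →
      (WPA1 μ fun N ω => M.HasUniqueSolution (fun i => w i ω) N (γ N ω) ∧
        M.IsEPLStep (fun i => w i ω) N (γ N ω) (γ' N ω)) →
      WPA1 μ fun N ω => ‖γ' N ω - mle N ω‖ ≤
        C * (‖fderiv ℝ (M.sampleQ (fun i => w i ω) N) M.γ₀‖ * ‖γ N ω - mle N ω‖
          + ‖γ N ω - mle N ω‖ ^ 2) := by
  obtain ⟨r, hr, C, hC, hint, hJ, hgood⟩ :=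
    exists_wpa1_isGoodObjective hA hR (κ := 1 / 2) (by norm_num) le_rfl
  refine ⟨C, hC, fun γ γ' hγ hs => ?_⟩
  refine (((hgood.and (wpa1_mle_mem_ball hA hR hmle hr)).and (hγ (r / 2) (half_pos hr))).and
    hs).mono' ?_
  rintro N ω ⟨⟨⟨h1, h2⟩, h3⟩, h4, h5⟩
  exact h1.norm_step_sub_mle_le hA hint hJ hr (Metric.ball_subset_closedBall h2) (hmle N ω)
    (Metric.ball_subset_closedBall h3) h4 h5

/-- The iteration preserves consistency. -/
theorem consistent_step [IsProbabilityMeasure μ] (hA : BasicAssumptions M μ w)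
    (hR : LikelihoodRegularity M) {mle : ℕ → Ω → Par p m}
    (hmle : ∀ N ω, M.IsMLE (fun i => w i ω) N (mle N ω)) {γ γ' : ℕ → Ω → Par p m}
    (hγ : ∀ ε > 0, WPA1 μ fun N ω => γ N ω ∈ Metric.ball M.γ₀ ε)
    (hs : WPA1 μ fun N ω => M.HasUniqueSolution (fun i => w i ω) N (γ N ω) ∧
      M.IsEPLStep (fun i => w i ω) N (γ N ω) (γ' N ω)) :
    ∀ ε > 0, WPA1 μ fun N ω => γ' N ω ∈ Metric.ball M.γ₀ ε := by
  intro ε hε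
  obtain ⟨C, hC, hstep⟩ := exists_step_bound hA hR hmle
  set s : ℝ := min (1 / 2) (ε / (4 * C + 1)) with hs'
  have hs0 : 0 < s := by positivity
  have hs1 : s ≤ 1 / 2 := min_le_left _ _
  have hs2 : (4 * C + 1) * s ≤ ε := by
    have : s ≤ ε / (4 * C + 1) := min_le_right _ _
    rwa [le_div_iff₀' (by positivity)] at this
  refine (((hstep γ γ' hγ hs).and (wpa1_mle_mem_ball hA hR hmle hs0)).and
    ((hγ s hs0).and (wpa1_score_le hA hR one_pos))).mono' ?_
  rintro N ω ⟨⟨h1, h2⟩, h3, h4⟩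
  rw [mem_ball_iff_norm] at h2 h3 ⊢
  set d := ‖γ N ω - mle N ω‖ with hd
  have hd0 : 0 ≤ d := norm_nonneg _
  have hds : d ≤ 2 * s := by
    have := norm_sub_le (γ N ω - M.γ₀) (mle N ω - M.γ₀)
    rw [sub_sub_sub_cancel_right] at this
    linarith
  have h5 : ‖fderiv ℝ (M.sampleQ (fun i => w i ω) N) M.γ₀‖ * d + d ^ 2 ≤ 4 * s := by
    have : ‖fderiv ℝ (M.sampleQ (fun i => w i ω) N) M.γ₀‖ * d ≤ 1 * d := by gcongr
    nlinarith
  have h6 : C * (‖fderiv ℝ (M.sampleQ (fun i => w i ω) N) M.γ₀‖ * d + d ^ 2) ≤ C * (4 * s) := by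
    gcongr
  have h7 := norm_add_le (γ' N ω - mle N ω) (mle N ω - M.γ₀)
  rw [sub_add_sub_cancel] at h7
  linarith

theorem isBigOp_step [IsProbabilityMeasure μ] (hA : BasicAssumptions M μ w)
    (hR : LikelihoodRegularity M) {mle : ℕ → Ω → Par p m}
    (hmle : ∀ N ω, M.IsMLE (fun i => w i ω) N (mle N ω)) {γ γ' : ℕ → Ω → Par p m}
    (hγ : ∀ ε > 0, WPA1 μ fun N ω => γ N ω ∈ Metric.ball M.γ₀ ε)
    (hs : WPA1 μ fun N ω => M.HasUniqueSolution (fun i => w i ω) N (γ N ω) ∧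
      M.IsEPLStep (fun i => w i ω) N (γ N ω) (γ' N ω)) :
    IsBigOp μ (fun N ω => γ' N ω - mle N ω) (fun N ω => (N : ℝ) ^ (-(1 / 2) : ℝ)
      * ‖γ N ω - mle N ω‖ + ‖γ N ω - mle N ω‖ ^ 2) := by
  intro ε hε
  obtain ⟨C, hC, hstep⟩ := exists_step_bound hA hR hmle
  obtain ⟨K, hK⟩ := isBigOp_score hA hR (ε / 2) (half_pos hε)
  refine ⟨C * (|K| + 1), ?_⟩
  filter_upwards [hK, (hstep γ γ' hγ hs).eventually_le (ENNReal.ofReal_pos.2 (half_pos hε))]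
    with N h1 h2
  rw [← add_halves ε, ENNReal.ofReal_add (half_pos hε).le (half_pos hε).le]
  refine (measure_mono fun ω hω => ?_).trans ((measure_union_le _ _).trans (add_le_add h1 h2))
  by_contra hnot
  simp only [mem_union, mem_ofPred_eq, not_or, not_lt, not_not] at hnot
  obtain ⟨h3, h4⟩ := hnot
  refine absurd hω (not_lt.2 (h4.trans ?_))
  rw [mul_assoc]
  gcongr
  set d := ‖γ N ω - mle N ω‖
  have hn : 0 ≤ (N : ℝ) ^ (-(1 / 2) : ℝ) := by positivity
  have h5 : ‖fderiv ℝ (M.sampleQ (fun i => w i ω) N) M.γ₀‖ * d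
      ≤ |K| * (N : ℝ) ^ (-(1 / 2) : ℝ) * d := by
    refine mul_le_mul_of_nonneg_right (h3.trans ?_) (norm_nonneg _)
    gcongr
    exact le_abs_self K
  have h6 : 0 ≤ (N : ℝ) ^ (-(1 / 2) : ℝ) * d := mul_nonneg hn (norm_nonneg _)
  have h7 : 0 ≤ |K| * d ^ 2 := by positivity
  linarith

end LargeSamples

end EPL

theorem theorem2 {p m : ℕ} {𝒲 Ω : Type*} [MeasurableSpace 𝒲] [MeasurableSpace Ω]
    (M : EPL.Model p m 𝒲) (μ : Measure Ω) [IsProbabilityMeasure μ] (w : ℕ → Ω → 𝒲)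
    (hA : EPL.BasicAssumptions M μ w) (hR : EPL.LikelihoodRegularity M)
    (mle : ℕ → Ω → EPL.Par p m)
    (hmle : ∀ N ω, M.IsMLE (fun i => w i ω) N (mle N ω)) :
    -- the MLE is a fixed point, in every sample with an interior nuisance estimate, a nonsingular
    -- Jacobian and a unique solution
    (∀ N ω, (mle N ω).2 ∈ interior M.𝒴 → (M.jacY (mle N ω)).IsInvertible →
      M.HasUniqueSolution (fun i => w i ω) N (mle N ω) →
      ∀ γ', M.IsEPLStep (fun i => w i ω) N (mle N ω) γ' ↔ γ' = mle N ω) ∧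
    -- the rate of approach to the MLE, for iterates from a consistent initial estimate
    (∀ γhat : ℕ → ℕ → Ω → EPL.Par p m,
      TendstoInMeasure μ (γhat 0) atTop (fun _ => M.γ₀) →
      (∀ k, EPL.WPA1 μ fun N ω => M.HasUniqueSolution (fun i => w i ω) N (γhat k N ω) ∧
        M.IsEPLStep (fun i => w i ω) N (γhat k N ω) (γhat (k + 1) N ω)) →
      ∀ k, EPL.IsBigOp μ (fun N ω => γhat (k + 1) N ω - mle N ω)
        (fun N ω => (N : ℝ) ^ (-(1 / 2) : ℝ) * ‖γhat k N ω - mle N ω‖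
          + ‖γhat k N ω - mle N ω‖ ^ 2)) ∧
    -- local contraction around the MLE with an arbitrarily small Lipschitz constant
    ((EPL.WPA1 μ fun N ω => M.HasUniqueSolution (fun i => w i ω) N (mle N ω)) →
      ∀ ε : ℝ, 0 < ε → EPL.WPA1 μ fun N ω =>
        ∃ B ∈ 𝓝 (mle N ω), B ⊆ M.Θ ×ˢ M.𝒴 ∧
          ∃ H : EPL.Par p m → EPL.Par p m,
            (∀ γ ∈ B, ∀ γ', M.IsEPLStep (fun i => w i ω) N γ γ' ↔ γ' = H γ) ∧
            MapsTo H B B ∧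
            ∃ L : ℝ≥0, (L : ℝ) < ε ∧ L < 1 ∧ LipschitzOnWith L H B) := by
  refine ⟨fun N ω h2 hJ hU γ' => EPL.mle_isEPLStep_iff hA (hmle N ω) h2 hJ hU γ', ?_, ?_⟩
  · intro γhat h0 hs k
    have hcons : ∀ k, ∀ ε > 0, EPL.WPA1 μ fun N ω => γhat k N ω ∈ Metric.ball M.γ₀ ε := by
      intro k
      induction k with
      | zero =>
        intro ε hε
        have h := tendstoInMeasure_iff_dist.1 h0 ε hε
        simpa [EPL.WPA1, not_lt] using h
      | succ k ih => exact EPL.consistent_step hA hR hmle ih (hs k)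
    exact EPL.isBigOp_step hA hR hmle (hcons k) (hs k)
  · intro hU ε hε
    obtain ⟨κ, hκ, hκ1, hκε⟩ : ∃ κ : ℝ≥0, (0 : ℝ) < κ ∧ (κ : ℝ) ≤ 1 / 2 ∧ (κ : ℝ) < ε :=
      ⟨⟨min (1 / 2) (ε / 2), by positivity⟩, lt_min one_half_pos (half_pos hε),
        min_le_left _ _, (min_le_right _ _).trans_lt (half_lt_self hε)⟩
    obtain ⟨r, hr, C, -, hint, hJ, hgood⟩ :=
      EPL.exists_wpa1_isGoodObjective hA hR (κ := κ) hκ hκ1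
    refine ((hgood.and (EPL.wpa1_mle_mem_ball hA hR hmle hr)).and hU).mono' ?_
    rintro N ω ⟨⟨h1, h2⟩, h3⟩
    have hκ2 : κ < 1 := by
      rw [← NNReal.coe_lt_coe, NNReal.coe_one]
      linarith
    obtain ⟨B, hB, hBs, H, hH, hmaps, hlip⟩ :=
      EPL.exists_contraction hA h1 hκ2 hint hJ h2 (hmle N ω) h3
    exact ⟨B, hB, hBs, H, hH, hmaps, κ, hκε, hκ2, hlip⟩
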